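/- Let $n\ge 1$, $k\in\mathbb N\cup\{0\}$, $\alpha\in(\mathbb N\cup\{0\})^n$, $1<q\le p<\infty$, $1\le r\le\infty$, $1<s<\infty$ and $\gamma>0$, and assume that $$\frac nq-\frac np<\gamma<n-\frac np .$$ For a measurable function $f$ on $\mathbb R^n$ put $$\|f\|_{\mathcal M^p_{q}}=\sup_{x\in\mathbb R^n,\,t>0}t^{\frac np-\frac nq}\Big(\int_{B(x,t)}|f(y)|^q\,dy\Big)^{\frac1q},\qquad \|f\|_{\mathcal M^p_{q,r}}=\sup_{x\in\mathbb R^n}\Big(\int_0^\infty\Big[t^{\frac np-\frac nq}\Big(\int_{B(x,t)}|f(y)|^q\,dy\Big)^{\frac1q}\Big]^r\frac{dt}t\Big)^{\frac1r}\ (r<\infty),$$ $\|f\|_{\mathcal M^p_{q,\infty}}=\|f\|_{\mathcal M^p_q}$, and $$\|f\|_{L^{s,r}}=\Big(\int_0^\infty\big[t\,|\{x:|f(x)|>t\}|^{\frac1s}\big]^r\frac{dt}t\Big)^{\frac1r}\ (r<\infty),\qquad \|f\|_{L^{s,\infty}}=\sup_{t>0}t\,|\{x:|f(x)|>t\}|^{\frac1s};$$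 $\mathcal M^p_q(\mathbb R^n)$ and $\mathcal M^p_{q,r}(\mathbb R^n)$ are the spaces of measurable (real- or complex-valued) functions for which the respective norm is finite. Let $$e^{t\Delta}g(x)=(4\pi t)^{-\frac n2}\int_{\mathbb R^n}e^{-\frac{|x-y|^2}{4t}}g(y)\,dy,\qquad (t,x)\in(0,\infty)\times\mathbb R^n .$$ Then, for every $f$ in $\mathcal M^p_{q,r}(\mathbb R^n)$ when $q\le s$, and for every $f$ in $\mathcal M^p_q(\mathbb R^n)$ when $q<s$, the integral defining $e^{t\Delta}[|\cdot|^{-\gamma}f](x)$ converges absolutely for all $t>0$ and $x\in\mathbb R^n$ and is a $C^\infty$ function of $(t,x)\in(0,\infty)\times\mathbb R^n$. Moreover: (1) If $q\le s$, there exists $C>0$ such that for all $t>0$ and $f\in\mathcal M^p_{q,r}(\mathbb R^n)$, $$\|\partial_t^k\partial_x^\alpha e^{t\Delta}[|\cdot|^{-\gamma}f]\|_{L^{s,r}}\le C\,t^{-\frac n2\left(\frac1p-\frac1s\right)-k-\frac{|\alpha|}2-\frac\gamma2}\,\|f\|_{\mathcal M^p_{q,r}} .$$ (2) If $q<s$,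 there exists $C>0$ such that for all $t>0$ and $f\in\mathcal M^p_q(\mathbb R^n)$, $$\|\partial_t^k\partial_x^\alpha e^{t\Delta}[|\cdot|^{-\gamma}f]\|_{L^s}\le C\,t^{-\frac n2\left(\frac1p-\frac1s\right)-k-\frac{|\alpha|}2-\frac\gamma2}\,\|f\|_{\mathcal M^p_q} .$$ -/

import Mathlib

open MeasureTheory Set
open scoped ENNReal

noncomputable section

namespace HeatMorrey

/-- Euclidean space `ℝⁿ`. -/
abbrev Rn (n : ℕ) : Type := EuclideanSpace ℝ (Fin n)

/-! ### Function spaces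

All (quasi-)norms take values in `[0, ∞]`; the spaces consist of the Lebesgue measurable functions
whose norm is finite. -/

/-- The quantity `t ^ (n/p - n/q) * (∫_{B(x,t)} |f|^q) ^ (1/q)`, for `t > 0`. -/
def morreyLocal {n : ℕ} {F : Type*} [NormedAddCommGroup F] (p q : ℝ) (f : Rn n → F)
    (x : Rn n) (t : ℝ) : ℝ≥0∞ :=
  ENNReal.ofReal (t ^ ((n : ℝ) / p - (n : ℝ) / q)) *
    (∫⁻ y in Metric.ball x t, ‖f y‖ₑ ^ q) ^ (1 / q)

/-- The Morrey norm `‖f‖_{M^p_q}`. -/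
def morreyNorm {n : ℕ} {F : Type*} [NormedAddCommGroup F] (p q : ℝ) (f : Rn n → F) : ℝ≥0∞ :=
  ⨆ (x : Rn n) (t : ℝ) (_ : 0 < t), morreyLocal p q f x t

open Classical in
/-- The global Morrey-type norm `‖f‖_{M^p_{q,r}}`, `1 ≤ r ≤ ∞`. -/
def morreyTypeNorm {n : ℕ} {F : Type*} [NormedAddCommGroup F] (p q : ℝ) (r : ℝ≥0∞)
    (f : Rn n → F) : ℝ≥0∞ :=
  if r = ⊤ then ⨆ (x : Rn n) (t : ℝ) (_ : 0 < t), morreyLocal p q f x t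
  else ⨆ x : Rn n,
    (∫⁻ t in Ioi (0 : ℝ), (morreyLocal p q f x t) ^ r.toReal / ENNReal.ofReal t) ^ (1 / r.toReal)

open Classical in
/-- The Lorentz quasi-norm `‖f‖_{L^{p,r}}`, `1 ≤ r ≤ ∞`. Here `volume {|f| > t} ^ (1/p)` is the
`L^p` norm of the indicator function of `{|f| > t}`. -/
def lorentzNorm {n : ℕ} {F : Type*} [NormedAddCommGroup F] (p : ℝ) (r : ℝ≥0∞)
    (f : Rn n → F) : ℝ≥0∞ :=
  if r = ⊤ then
    ⨆ (t : ℝ) (_ : 0 < t), ENNReal.ofReal t * volume {x : Rn n | t < ‖f x‖} ^ (1 / p)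
  else
    (∫⁻ t in Ioi (0 : ℝ),
      (ENNReal.ofReal t * volume {x : Rn n | t < ‖f x‖} ^ (1 / p)) ^ r.toReal /
        ENNReal.ofReal t) ^ (1 / r.toReal)

/-- Membership in the Morrey space `M^p_q(ℝⁿ)`. -/
def MemMorrey {n : ℕ} {F : Type*} [NormedAddCommGroup F] (p q : ℝ) (f : Rn n → F) : Prop :=
  AEStronglyMeasurable f volume ∧ morreyNorm p q f < ⊤

/-- Membership in the global Morrey-type space `M^p_{q,r}(ℝⁿ)`. -/
def MemMorreyType {n : ℕ} {F : Type*} [NormedAddCommGroup F] (p q : ℝ) (r : ℝ≥0∞)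
    (f : Rn n → F) : Prop :=
  AEStronglyMeasurable f volume ∧ morreyTypeNorm p q r f < ⊤

/-! ### The heat semigroup and its derivatives -/

/-- The weighted function `|·|^{-γ} f`. -/
def weighted {n : ℕ} {F : Type*} [NormedAddCommGroup F] [NormedSpace ℝ F] (γ : ℝ)
    (f : Rn n → F) : Rn n → F :=
  fun y => (‖y‖ ^ (-γ)) • f y

/-- The heat semigroup
`e^{tΔ} g (x) = (4πt)^{-n/2} ∫ exp(-|x - y|² / (4t)) g(y) dy`, for `t > 0`. -/
def heat {n : ℕ} {F : Type*} [NormedAddCommGroup F] [NormedSpace ℝ F] (t : ℝ)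
    (g : Rn n → F) (x : Rn n) : F :=
  (1 / Real.sqrt ((4 * Real.pi * t) ^ n)) • ∫ y, Real.exp (-‖x - y‖ ^ 2 / (4 * t)) • g y

/-- The partial derivative `∂_{x_i}`. -/
def partialDeriv {n : ℕ} {F : Type*} [NormedAddCommGroup F] [NormedSpace ℝ F] (i : Fin n)
    (g : Rn n → F) : Rn n → F :=
  fun x => lineDeriv ℝ g x (EuclideanSpace.single i 1)

/-- The derivative `∂_x^α = ∂_{x_1}^{α_1} ⋯ ∂_{x_n}^{α_n}` for a multi-index `α`. -/
def multiDeriv {n : ℕ} {F : Type*} [NormedAddCommGroup F] [NormedSpace ℝ F] (α : Fin n → ℕ)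
    (g : Rn n → F) : Rn n → F :=
  (List.finRange n).foldr (fun i h => (partialDeriv i)^[α i] h) g

/-- The function `∂_t^k ∂_x^α e^{tΔ} g` at time `t > 0`. -/
def heatDeriv {n : ℕ} {F : Type*} [NormedAddCommGroup F] [NormedSpace ℝ F] (k : ℕ)
    (α : Fin n → ℕ) (t : ℝ) (g : Rn n → F) (x : Rn n) : F :=
  iteratedDeriv k (fun τ => multiDeriv α (heat τ g) x) t

/-- `(t, x) ↦ e^{tΔ} g (x)` is a well-defined smooth function on `(0, ∞) × ℝⁿ`: the integral that
defines it converges absolutely everywhere, and it is jointly `C^∞`, so that all derivatives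
`∂_t^k ∂_x^α e^{tΔ} g` exist in the classical sense. -/
def HeatSmooth {n : ℕ} {F : Type*} [NormedAddCommGroup F] [NormedSpace ℝ F]
    (g : Rn n → F) : Prop :=
  (∀ t : ℝ, 0 < t → ∀ x : Rn n,
    Integrable (fun y => Real.exp (-‖x - y‖ ^ 2 / (4 * t)) • g y) volume) ∧
  ContDiffOn ℝ ((⊤ : ℕ∞) : WithTop ℕ∞) (fun z : ℝ × Rn n => heat z.1 g z.2)
    (Ioi (0 : ℝ) ×ˢ (univ : Set (Rn n)))

end HeatMorrey

end

/-! The derivative `∂_t^k ∂_x^α e^{tΔ} g` is convolution of g with a kernel bounded by t^{-m/2}, m =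
2k + |α|, times a Gaussian of width √t whose height is t^{-n/2} and whose mass does not depend on t.
So it suffices to convolve |·|^{-γ} f with that Gaussian.

Choose θ with 1 ≤ θ < q and n/θ - n/p < γ (`exists_exponent`), and split |·|^{-γ} f at the heat
scale |y| = √t. By Hölder, the Morrey norm bounds the integral of |f|^θ over B(0, ρ) by a multiple
of ρ^{n - θn/p}, and likewise with θ = 1. Writing the weight as an integral over radii, γ < n - n/p
makes the inner part integrable, and γθ > n - θn/p puts the outer part in L^θ. Convolution with the
Gaussian sends both parts into L^θ ∩ L^∞ with matching powers of t (`exists_conv_bound`,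
`exists_gaussianMajorant_conv_bound`).

Since θ < q ≤ s, elementary interpolation between L^θ and L^∞ reaches L^s and every L^{s,r}
(`eLpNorm_le_of_bounded`, `exists_lorentzNorm_le_of_bounded`). No finer information on f than its
Morrey norm is needed: `exists_morreyNorm_le` embeds M^p_{q,r} in M^p_q. Smoothness follows by
differentiating under the integral, the kernel class `IsHeatKernel` being closed under
differentiation. -/

namespace HeatMorrey

/-! ### Derivatives of the heat kernel -/

/-- The continuous linear map on `ℝ × ℝⁿ` with prescribed values on the standard basis. -/
noncomputable def ofPartials {n : ℕ} {F : Type*} [NormedAddCommGroup F] [NormedSpace ℝ F]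
    (a : F) (b : Fin n → F) : ℝ × Rn n →L[ℝ] F :=
  (ContinuousLinearMap.fst ℝ ℝ (Rn n)).smulRight a +
    ∑ i, ((EuclideanSpace.proj i : Rn n →L[ℝ] ℝ).comp
      (ContinuousLinearMap.snd ℝ ℝ (Rn n))).smulRight (b i)

theorem ofPartials_apply {n : ℕ} {F : Type*} [NormedAddCommGroup F] [NormedSpace ℝ F]
    (a : F) (b : Fin n → F) (w : ℝ × Rn n) :
    ofPartials a b w = w.1 • a + ∑ i, w.2 i • b i := by
  simp [ofPartials]

/-- Linear combinations of `t ^ (-n/2 - j) x ^ β exp (-|x|² / (4 t))` with `2 j - |β| = m`. -/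
inductive IsHeatKernel (n : ℕ) : ℕ → (ℝ × Rn n → ℝ) → Prop
  | gauss : IsHeatKernel n 0
      (fun z => z.1 ^ (-((n : ℝ) / 2)) * Real.exp (-‖z.2‖ ^ 2 / (4 * z.1)))
  | zero (m : ℕ) : IsHeatKernel n m (fun _ => 0)
  | add {m : ℕ} {K L : ℝ × Rn n → ℝ} : IsHeatKernel n m K → IsHeatKernel n m L →
      IsHeatKernel n m (fun z => K z + L z)
  | const_mul {m : ℕ} {K : ℝ × Rn n → ℝ} (c : ℝ) : IsHeatKernel n m K →
      IsHeatKernel n m (fun z => c * K z)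
  | inv_mul {m : ℕ} {K : ℝ × Rn n → ℝ} : IsHeatKernel n m K →
      IsHeatKernel n (m + 2) (fun z => z.1⁻¹ * K z)
  | coord_mul {m : ℕ} {K : ℝ × Rn n → ℝ} (i : Fin n) : IsHeatKernel n m K →
      IsHeatKernel n (m + 1) (fun z => z.2 i * z.1⁻¹ * K z)

namespace IsHeatKernel

variable {n m : ℕ} {K : ℝ × Rn n → ℝ}

theorem sum {ι : Type*} (s : Finset ι) {K : ι → ℝ × Rn n → ℝ}
    (h : ∀ i ∈ s, IsHeatKernel n m (K i)) : IsHeatKernel n m (fun z => ∑ i ∈ s, K i z) := by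
  classical
  induction s using Finset.induction_on with
  | empty => simpa using IsHeatKernel.zero m
  | insert a s ha ih =>
    simp only [Finset.sum_insert ha]
    exact (h a (by simp)).add (ih fun i hi => h i (by simp [hi]))

/-- The factor ‖x‖² in the time derivative is expanded into coordinates so that each coefficient is
literally a term built by the constructors of `IsHeatKernel`. -/
theorem hasFDerivAt_gauss {z : ℝ × Rn n} (hz : 0 < z.1) :
    HasFDerivAt (fun z : ℝ × Rn n =>
        z.1 ^ (-((n : ℝ) / 2)) * Real.exp (-‖z.2‖ ^ 2 / (4 * z.1)))
      (ofPartials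
        (-((n : ℝ) / 2) * (z.1⁻¹ *
            (z.1 ^ (-((n : ℝ) / 2)) * Real.exp (-‖z.2‖ ^ 2 / (4 * z.1)))) +
          ∑ i, 1 / 4 * (z.2 i * z.1⁻¹ * (z.2 i * z.1⁻¹ *
            (z.1 ^ (-((n : ℝ) / 2)) * Real.exp (-‖z.2‖ ^ 2 / (4 * z.1))))))
        (fun i => -(1 / 2) * (z.2 i * z.1⁻¹ *
            (z.1 ^ (-((n : ℝ) / 2)) * Real.exp (-‖z.2‖ ^ 2 / (4 * z.1)))))) z := by
  have h1 : HasFDerivAt (fun z : ℝ × Rn n => z.1 ^ (-((n : ℝ) / 2))) _ z :=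
    (Real.hasDerivAt_rpow_const (p := -((n : ℝ) / 2)) (Or.inl hz.ne')).comp_hasFDerivAt z
      (hasFDerivAt_fst (𝕜 := ℝ))
  have h2 : HasFDerivAt (fun z : ℝ × Rn n => z.1⁻¹) _ z :=
    (hasDerivAt_inv hz.ne').comp_hasFDerivAt z (hasFDerivAt_fst (𝕜 := ℝ))
  have h3 : HasFDerivAt (fun z : ℝ × Rn n => ‖z.2‖ ^ 2) _ z :=
    (hasFDerivAt_snd (𝕜 := ℝ) (p := z)).norm_sq
  have h4 := h1.mul (((h3.mul h2).const_mul (-(1 / 4))).exp)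
  have e : (fun z : ℝ × Rn n => z.1 ^ (-((n : ℝ) / 2)) * Real.exp (-‖z.2‖ ^ 2 / (4 * z.1))) =
      fun z : ℝ × Rn n =>
        z.1 ^ (-((n : ℝ) / 2)) * Real.exp (-(1 / 4) * (‖z.2‖ ^ 2 * z.1⁻¹)) := by
    funext w
    congr 2
    rw [div_eq_mul_inv, mul_inv]
    ring
  rw [e]
  refine h4.congr_fderiv ?_
  have e' : Real.exp (-‖z.2‖ ^ 2 / (4 * z.1)) =
      Real.exp (-(1 / 4) * (‖z.2‖ ^ 2 * z.1⁻¹)) := by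
    congr 1
    rw [div_eq_mul_inv, mul_inv]
    ring
  refine ContinuousLinearMap.ext fun w => ?_
  have e2 : inner ℝ z.2 w.2 = ∑ i, w.2 i * z.2 i := by
    simp [PiLp.inner_apply]
  have e3 : ‖z.2‖ ^ 2 = ∑ i, z.2 i * z.2 i := by
    rw [EuclideanSpace.real_norm_sq_eq]
    simp [sq]
  rw [ofPartials_apply, e', Real.rpow_sub_one hz.ne']
  have s1 : ∀ E : ℝ, ∑ i, 1 / 4 * (z.2 i * z.1⁻¹ * (z.2 i * z.1⁻¹ * E)) =
      1 / 4 * (z.1⁻¹) ^ 2 * E * ‖z.2‖ ^ 2 := by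
    intro E
    rw [e3, Finset.mul_sum]
    exact Finset.sum_congr rfl fun i _ => by ring
  have s2 : ∀ E : ℝ, ∑ i, w.2 i * (-(1 / 2) * (z.2 i * z.1⁻¹ * E)) =
      -(1 / 2) * z.1⁻¹ * E * inner ℝ z.2 w.2 := by
    intro E
    rw [e2, Finset.mul_sum]
    exact Finset.sum_congr rfl fun i _ => by ring
  simp only [smul_eq_mul]
  rw [s1, s2]
  simp
  field_simp
  ring

/-- The index m counts parabolic order: a time derivative costs 2 and a space derivative costs 1,
matching the powers of t^{-1/2} in `exists_bound`. -/
theorem exists_hasFDerivAt (h : IsHeatKernel n m K) :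
    ∃ (T : ℝ × Rn n → ℝ) (X : Fin n → ℝ × Rn n → ℝ), IsHeatKernel n (m + 2) T ∧
      (∀ i, IsHeatKernel n (m + 1) (X i)) ∧
      ∀ z : ℝ × Rn n, 0 < z.1 → HasFDerivAt K (ofPartials (T z) fun i => X i z) z := by
  induction h with
  | gauss =>
    exact ⟨_, _, (gauss.inv_mul.const_mul _).add
      (sum _ fun i _ => ((gauss.coord_mul i).coord_mul i).const_mul _),
      fun i => (gauss.coord_mul i).const_mul _, fun z hz => hasFDerivAt_gauss hz⟩
  | zero m =>
    refine ⟨_, _, zero _, fun _ => zero _, fun z _ => (hasFDerivAt_const (0 : ℝ) z).congr_fderiv ?_⟩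
    ext <;> simp [ofPartials_apply]
  | add hK hL ihK ihL =>
    obtain ⟨T, X, hT, hX, hd⟩ := ihK
    obtain ⟨T', X', hT', hX', hd'⟩ := ihL
    refine ⟨_, _, hT.add hT', fun i => (hX i).add (hX' i),
      fun z hz => ((hd z hz).add (hd' z hz)).congr_fderiv ?_⟩
    refine ContinuousLinearMap.ext fun w => ?_
    simp only [add_apply, ofPartials_apply, smul_eq_mul, mul_add,
      Finset.sum_add_distrib]
    ring
  | const_mul c hK ih =>
    obtain ⟨T, X, hT, hX, hd⟩ := ih
    refine ⟨_, _, hT.const_mul c, fun i => (hX i).const_mul c,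
      fun z hz => ((hd z hz).const_mul c).congr_fderiv ?_⟩
    refine ContinuousLinearMap.ext fun w => ?_
    simp only [smul_apply, ofPartials_apply, smul_eq_mul, mul_add,
      Finset.mul_sum]
    congr 1
    · ring
    · exact Finset.sum_congr rfl fun i _ => by ring
  | @inv_mul m K hK ih =>
    obtain ⟨T, X, hT, hX, hd⟩ := ih
    refine ⟨_, _, hT.inv_mul.add (hK.inv_mul.inv_mul.const_mul (-1)),
      fun i => (hX i).inv_mul, fun z hz => ?_⟩
    have h2 : HasFDerivAt (fun z : ℝ × Rn n => z.1⁻¹) _ z :=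
      (hasDerivAt_inv hz.ne').comp_hasFDerivAt z (hasFDerivAt_fst (𝕜 := ℝ))
    refine (h2.mul (hd z hz)).congr_fderiv ?_
    refine ContinuousLinearMap.ext fun w => ?_
    have s1 : ∑ i, w.2 i * (z.1⁻¹ * X i z) = z.1⁻¹ * ∑ i, w.2 i * X i z := by
      rw [Finset.mul_sum]
      exact Finset.sum_congr rfl fun i _ => by ring
    simp only [add_apply, smul_apply, ofPartials_apply, smul_eq_mul, ContinuousLinearMap.coe_fst']
    rw [s1]
    simp
    field_simp
    ring
  | @coord_mul m K j hK ih =>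
    obtain ⟨T, X, hT, hX, hd⟩ := ih
    -- Product rule for x_j t⁻¹ K; the Kronecker delta from ∂_i x_j enters as a constant multiple 0
    -- or 1, so that all i are treated alike.
    refine ⟨_, fun i => _, (hT.coord_mul j).add ((hK.coord_mul j).inv_mul.const_mul (-1)),
      fun i => ((hX i).coord_mul j).add (hK.inv_mul.const_mul (if i = j then 1 else 0)),
      fun z hz => ?_⟩
    have h2 : HasFDerivAt (fun z : ℝ × Rn n => z.1⁻¹) _ z :=
      (hasDerivAt_inv hz.ne').comp_hasFDerivAt z (hasFDerivAt_fst (𝕜 := ℝ))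
    have h3 : HasFDerivAt (fun z : ℝ × Rn n => z.2 j) _ z :=
      ((EuclideanSpace.proj j : Rn n →L[ℝ] ℝ).comp
        (ContinuousLinearMap.snd ℝ ℝ (Rn n))).hasFDerivAt
    refine ((h3.mul h2).mul (hd z hz)).congr_fderiv ?_
    refine ContinuousLinearMap.ext fun w => ?_
    have s1 : ∑ i, w.2 i * ((z.2 j * z.1⁻¹ * X i z) + (if i = j then 1 else 0) * (z.1⁻¹ * K z)) =
        z.2 j * z.1⁻¹ * ∑ i, w.2 i * X i z + w.2 j * (z.1⁻¹ * K z) := by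
      simp only [mul_add, Finset.sum_add_distrib, Finset.mul_sum]
      congr 1
      · exact Finset.sum_congr rfl fun i _ => by ring
      · simp
    simp only [add_apply, smul_apply, ofPartials_apply,
      smul_eq_mul, ContinuousLinearMap.coe_fst']
    rw [s1]
    simp
    field_simp
    ring

/-- Each polynomial factor is absorbed by giving up a little of the Gaussian rate 1/4. The rate c is
generalized in the induction because it changes at every coordinate factor. -/
theorem exists_bound (h : IsHeatKernel n m K) {c : ℝ} (hc : c < 1 / 4) :
    ∃ C : ℝ, 0 ≤ C ∧ ∀ t : ℝ, 0 < t → ∀ x : Rn n,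
      |K (t, x)| ≤ C * t ^ (-((m : ℝ) / 2) - (n : ℝ) / 2) * Real.exp (-c * ‖x‖ ^ 2 / t) := by
  induction h generalizing c with
  | gauss =>
    refine ⟨1, zero_le_one, fun t ht x => ?_⟩
    have := Real.rpow_nonneg ht.le (-((n : ℝ) / 2))
    rw [abs_of_nonneg (by positivity)]
    simp only [Nat.cast_zero, zero_div, neg_zero, zero_sub, one_mul]
    refine mul_le_mul_of_nonneg_left (Real.exp_le_exp.2 ?_) this
    rw [neg_div, neg_mul, neg_div, neg_le_neg_iff, div_le_div_iff₀ ht (by positivity)]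
    nlinarith [mul_nonneg (sq_nonneg ‖x‖) ht.le]
  | zero m => exact ⟨0, le_rfl, fun t ht x => by simp⟩
  | add hK hL ihK ihL =>
    obtain ⟨C, hC, hb⟩ := ihK hc
    obtain ⟨C', hC', hb'⟩ := ihL hc
    refine ⟨C + C', by positivity, fun t ht x => (abs_add_le _ _).trans ?_⟩
    rw [add_mul, add_mul]
    exact add_le_add (hb t ht x) (hb' t ht x)
  | const_mul a hK ih =>
    obtain ⟨C, hC, hb⟩ := ih hc
    refine ⟨|a| * C, by positivity, fun t ht x => ?_⟩
    rw [abs_mul, mul_assoc, mul_assoc, ← mul_assoc C]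
    exact mul_le_mul_of_nonneg_left (hb t ht x) (abs_nonneg _)
  | @inv_mul m K hK ih =>
    obtain ⟨C, hC, hb⟩ := ih hc
    refine ⟨C, hC, fun t ht x => ?_⟩
    rw [abs_mul, abs_of_pos (inv_pos.2 ht)]
    refine (mul_le_mul_of_nonneg_left (hb t ht x) (inv_pos.2 ht).le).trans_eq ?_
    have : t ^ (-(((m + 2 : ℕ) : ℝ) / 2) - (n : ℝ) / 2) =
        t⁻¹ * t ^ (-((m : ℝ) / 2) - (n : ℝ) / 2) := by
      rw [← Real.rpow_neg_one, ← Real.rpow_add ht]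
      congr 1
      push_cast
      ring
    rw [this]
    ring
  | @coord_mul m K i hK ih =>
    -- The induction hypothesis is used at a rate strictly between c and 1/4; the surplus c' - c
    -- pays for the factor |x|/t. Capping δ at 1 makes δ‖x‖√t ≤ t + δ‖x‖² hold.
    set c' := (c + 1 / 4) / 2 with hc'
    obtain ⟨C, hC, hb⟩ := ih (c := c') (by linarith)
    have hδ : 0 < min (c' - c) 1 := lt_min (by linarith) one_pos
    set δ := min (c' - c) 1
    refine ⟨δ⁻¹ * C, by positivity, fun t ht x => ?_⟩
    have hu : ‖x‖ * t⁻¹ ≤ δ⁻¹ * t ^ (-(1 / 2) : ℝ) * Real.exp (δ * ‖x‖ ^ 2 / t) := by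
      have h1 : 1 + δ * ‖x‖ ^ 2 / t ≤ Real.exp (δ * ‖x‖ ^ 2 / t) := by
        linarith [Real.add_one_le_exp (δ * ‖x‖ ^ 2 / t)]
      have h2 : t ^ (-(1 / 2) : ℝ) = (√t)⁻¹ := by
        rw [Real.rpow_neg ht.le, Real.sqrt_eq_rpow]
      rw [h2, mul_assoc, ← div_eq_inv_mul, le_div_iff₀ hδ]
      have hs : 0 < √t := Real.sqrt_pos.2 ht
      refine le_trans ?_ (mul_le_mul_of_nonneg_left h1 (inv_pos.2 hs).le)
      have h3 : t = √t * √t := (Real.mul_self_sqrt ht.le).symm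
      have hδ1 : δ ≤ 1 := min_le_right _ _
      have key : ‖x‖ * δ * √t ≤ √t ^ 2 + δ * ‖x‖ ^ 2 := by
        nlinarith [sq_nonneg (√t - ‖x‖), norm_nonneg x, sq_nonneg (√t),
          mul_nonneg (norm_nonneg x) hs.le]
      have e1 : ‖x‖ * t⁻¹ * δ = (‖x‖ * δ * √t) / (√t ^ 3) := by
        rw [h3]; simp only [Real.sqrt_mul_self hs.le]; field_simp
      have e2 : (√t)⁻¹ * (1 + δ * ‖x‖ ^ 2 / t) = (√t ^ 2 + δ * ‖x‖ ^ 2) / (√t ^ 3) := by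
        rw [h3]; simp only [Real.sqrt_mul_self hs.le]; field_simp
      rw [e1, e2]
      gcongr
    have hxi : |x i| ≤ ‖x‖ := by simpa using PiLp.norm_apply_le x i
    have ht' := inv_pos.2 ht
    have hexp : Real.exp (δ * ‖x‖ ^ 2 / t) * Real.exp (-c' * ‖x‖ ^ 2 / t) ≤
        Real.exp (-c * ‖x‖ ^ 2 / t) := by
      rw [← Real.exp_add, ← add_div, ← add_mul]
      gcongr
      linarith [min_le_left (c' - c) 1]
    have hp : t ^ (-(((m + 1 : ℕ) : ℝ) / 2) - (n : ℝ) / 2) =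
        t ^ (-(1 / 2) : ℝ) * t ^ (-((m : ℝ) / 2) - (n : ℝ) / 2) := by
      rw [← Real.rpow_add ht]
      congr 1
      push_cast
      ring
    have hp1 := Real.rpow_nonneg ht.le (-(1 / 2) : ℝ)
    have hp2 := Real.rpow_nonneg ht.le (-((m : ℝ) / 2) - (n : ℝ) / 2)
    calc |x i * t⁻¹ * K (t, x)| = |x i| * t⁻¹ * |K (t, x)| := by
          rw [abs_mul, abs_mul, abs_of_pos ht']
      _ ≤ (δ⁻¹ * t ^ (-(1 / 2) : ℝ) * Real.exp (δ * ‖x‖ ^ 2 / t)) *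
          (C * t ^ (-((m : ℝ) / 2) - (n : ℝ) / 2) * Real.exp (-c' * ‖x‖ ^ 2 / t)) := by
          exact mul_le_mul ((mul_le_mul_of_nonneg_right hxi ht'.le).trans hu) (hb t ht x)
            (abs_nonneg _) (by positivity)
      _ = δ⁻¹ * C * (t ^ (-(1 / 2) : ℝ) * t ^ (-((m : ℝ) / 2) - (n : ℝ) / 2)) *
          (Real.exp (δ * ‖x‖ ^ 2 / t) * Real.exp (-c' * ‖x‖ ^ 2 / t)) := by ring
      _ ≤ _ := by
          rw [hp]
          gcongr

end IsHeatKernel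

/-! ### Differentiation under the integral sign and smoothness of kernel integrals. -/

section Smooth

variable {n : ℕ} {F : Type*} [NormedAddCommGroup F] [NormedSpace ℝ F]

theorem norm_ofPartials_le (a : F) (b : Fin n → F) :
    ‖ofPartials a b‖ ≤ ‖a‖ + ∑ i, ‖b i‖ := by
  refine ContinuousLinearMap.opNorm_le_bound _ (by positivity) fun w => ?_
  rw [ofPartials_apply, add_mul, Finset.sum_mul]
  refine (norm_add_le _ _).trans (add_le_add ?_ ((norm_sum_le _ _).trans
    (Finset.sum_le_sum fun i _ => ?_)))
  · rw [norm_smul, mul_comm]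
    exact mul_le_mul_of_nonneg_left (norm_fst_le w) (norm_nonneg _)
  · rw [norm_smul, mul_comm]
    exact mul_le_mul_of_nonneg_left ((PiLp.norm_apply_le w.2 i).trans (norm_snd_le w))
      (norm_nonneg _)

theorem integrable_ofPartials {a : Rn n → F} {b : Fin n → Rn n → F} (ha : Integrable a)
    (hb : ∀ i, Integrable (b i)) : Integrable fun y => ofPartials (a y) fun i => b i y := by
  unfold ofPartials
  refine ((ContinuousLinearMap.smulRightL ℝ (ℝ × Rn n) F _).integrable_comp ha).add
    (integrable_finsetSum _ fun i _ => ?_)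
  exact (ContinuousLinearMap.smulRightL ℝ (ℝ × Rn n) F _).integrable_comp (hb i)

theorem integral_ofPartials [CompleteSpace F] {a : Rn n → F} {b : Fin n → Rn n → F}
    (ha : Integrable a) (hb : ∀ i, Integrable (b i)) :
    ∫ y, ofPartials (a y) (fun i => b i y) = ofPartials (∫ y, a y) fun i => ∫ y, b i y := by
  refine ContinuousLinearMap.ext fun w => ?_
  rw [ContinuousLinearMap.integral_apply (integrable_ofPartials ha hb)]
  simp only [ofPartials_apply]
  have h1 : Integrable fun y => w.1 • a y := ha.smul _
  have h2 : ∀ i ∈ Finset.univ, Integrable fun y => w.2 i • b i y := fun i _ => (hb i).smul _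
  rw [integral_add h1 (integrable_finsetSum _ h2), integral_smul, integral_finsetSum _ h2]
  simp only [integral_smul]

/-- Integrability against every Gaussian. -/
def GaussIntegrable (g : Rn n → F) : Prop :=
  ∀ c : ℝ, 0 < c → ∀ x : Rn n, Integrable fun y => Real.exp (-c * ‖x - y‖ ^ 2) • g y

theorem GaussIntegrable.aestronglyMeasurable {g : Rn n → F} (hg : GaussIntegrable g) :
    AEStronglyMeasurable g volume := by
  have h1 : Continuous fun y : Rn n => Real.exp (‖y‖ ^ 2) := by fun_prop
  refine (h1.aestronglyMeasurable.smul (hg 1 one_pos 0).aestronglyMeasurable).congr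
    (Filter.Eventually.of_forall fun y => ?_)
  simp [smul_smul, ← Real.exp_add]

/-- The integral of `g` against the kernel `K`. -/
noncomputable def kernelConv (K : ℝ × Rn n → ℝ) (g : Rn n → F) (w : ℝ × Rn n) : F :=
  ∫ y, K (w.1, w.2 - y) • g y

variable {m : ℕ} {K : ℝ × Rn n → ℝ}

/-- One fixed Gaussian dominates the kernel for all base points near w₀; this is the majorant
required by dominated differentiation. -/
theorem IsHeatKernel.exists_local_bound (h : IsHeatKernel n m K) {w₀ : ℝ × Rn n}
    (h₀ : 0 < w₀.1) : ∃ C c ε : ℝ, 0 < c ∧ 0 < ε ∧ ∀ w ∈ Metric.ball w₀ ε, 0 < w.1 ∧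
      ∀ y, |K (w.1, w.2 - y)| ≤ C * Real.exp (-c * ‖w₀.2 - y‖ ^ 2) := by
  obtain ⟨C, hC, hb⟩ := h.exists_bound (c := 1 / 8) (by norm_num)
  obtain ⟨t₀, x₀⟩ := w₀
  simp only at h₀
  set a : ℝ := -((m : ℝ) / 2) - (n : ℝ) / 2 with ha
  -- For t < 3t₀/2 the rate 1/(8t) is at least 1/(12t₀). Recentring from x to x₀ by ‖x₀ - y‖² ≤ 2‖x
  -- - y‖² + 2 halves it and leaves the factor exp(1/(12t₀)). As a ≤ 0, t^a is largest at t₀/2.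
  refine ⟨C * (t₀ / 2) ^ a * Real.exp (1 / (12 * t₀)), 1 / (24 * t₀), min (t₀ / 2) 1,
    by positivity, by positivity, ?_⟩
  rintro ⟨t, x⟩ hw
  rw [Metric.mem_ball, Prod.dist_eq, max_lt_iff, lt_min_iff, lt_min_iff, Real.dist_eq,
    abs_lt, dist_eq_norm] at hw
  obtain ⟨⟨⟨h1, h2⟩, -⟩, -, h3⟩ := hw
  simp only at h1 h2 h3 ⊢
  have ht : 0 < t := by linarith
  refine ⟨ht, fun y => (hb t ht (x - y)).trans ?_⟩
  have hp : t ^ a ≤ (t₀ / 2) ^ a :=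
    Real.rpow_le_rpow_of_nonpos (by linarith) (by linarith) (by
      have hm : (0 : ℝ) ≤ m := Nat.cast_nonneg m
      have hn : (0 : ℝ) ≤ n := Nat.cast_nonneg n
      rw [ha]
      linarith)
  rw [mul_assoc _ (Real.exp _), ← Real.exp_add]
  refine mul_le_mul (mul_le_mul_of_nonneg_left hp hC) (Real.exp_le_exp.2 ?_)
    (Real.exp_pos _).le (by positivity)
  have h4 : ‖x₀ - y‖ ^ 2 ≤ 2 * ‖x - y‖ ^ 2 + 2 := by
    have : ‖x₀ - y‖ ≤ ‖x - y‖ + 1 := by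
      calc ‖x₀ - y‖ = ‖(x - y) - (x - x₀)‖ := by congr 1; abel
        _ ≤ ‖x - y‖ + ‖x - x₀‖ := norm_sub_le _ _
        _ ≤ _ := by linarith
    nlinarith [norm_nonneg (x₀ - y), sq_nonneg (‖x - y‖ - 1)]
  have h5 : ‖x - y‖ ^ 2 / (12 * t₀) ≤ 1 / 8 * ‖x - y‖ ^ 2 / t := by
    rw [div_le_div_iff₀ (by positivity) ht]
    nlinarith [sq_nonneg ‖x - y‖]
  have h6 : 1 / (24 * t₀) * ‖x₀ - y‖ ^ 2 ≤ 1 / (24 * t₀) * (2 * ‖x - y‖ ^ 2 + 2) := by gcongr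
  have h7 : 1 / (24 * t₀) * (2 * ‖x - y‖ ^ 2 + 2) = ‖x - y‖ ^ 2 / (12 * t₀) + 1 / (12 * t₀) := by
    field_simp
    ring
  rw [neg_mul, neg_div, neg_mul]
  linarith

theorem IsHeatKernel.continuous (h : IsHeatKernel n m K) {t : ℝ} (ht : 0 < t) (x : Rn n) :
    Continuous fun y => K (t, x - y) := by
  obtain ⟨T, X, -, -, hd⟩ := h.exists_hasFDerivAt
  refine continuous_iff_continuousAt.2 fun y => ?_
  exact ContinuousAt.comp (f := fun y => (t, x - y)) (hd (t, x - y) ht).continuousAt (by fun_prop)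

theorem IsHeatKernel.integrable (h : IsHeatKernel n m K) {g : Rn n → F}
    (hg : GaussIntegrable g) {w : ℝ × Rn n} (hw : 0 < w.1) :
    Integrable fun y => K (w.1, w.2 - y) • g y := by
  obtain ⟨C, c, ε, hc, hε, hb⟩ := h.exists_local_bound hw
  refine Integrable.mono' ((hg c hc w.2).norm.const_mul C)
    ((h.continuous hw w.2).aestronglyMeasurable.smul hg.aestronglyMeasurable)
    (Filter.Eventually.of_forall fun y => ?_)
  rw [norm_smul, norm_smul, ← mul_assoc, Real.norm_eq_abs, Real.norm_eq_abs, Real.abs_exp]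
  exact mul_le_mul_of_nonneg_right ((hb w (Metric.mem_ball_self hε)).2 y) (norm_nonneg _)

/-- The derivative kernels are chosen before g, which is what later makes the constants independent
of f. -/
theorem IsHeatKernel.exists_hasFDerivAt_kernelConv [CompleteSpace F] (h : IsHeatKernel n m K) :
    ∃ (T : ℝ × Rn n → ℝ) (X : Fin n → ℝ × Rn n → ℝ), IsHeatKernel n (m + 2) T ∧
      (∀ i, IsHeatKernel n (m + 1) (X i)) ∧ ∀ g : Rn n → F, GaussIntegrable g →
      ∀ z : ℝ × Rn n, 0 < z.1 → HasFDerivAt (kernelConv K g)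
        (ofPartials (kernelConv T g z) fun i => kernelConv (X i) g z) z := by
  obtain ⟨T, X, hT, hX, hd⟩ := h.exists_hasFDerivAt
  refine ⟨T, X, hT, hX, fun g hg w₀ hw₀ => ?_⟩
  obtain ⟨C, c, ε, hc, hε, hb⟩ := hT.exists_local_bound hw₀
  choose C' c' ε' hc' hε' hb' using fun i => (hX i).exists_local_bound hw₀
  have hs : (Metric.ball w₀ ε ∩ ⋂ i, Metric.ball w₀ (ε' i)) ∈ nhds w₀ :=
    Filter.inter_mem (Metric.ball_mem_nhds _ hε)
      (Filter.iInter_mem.2 fun i => Metric.ball_mem_nhds _ (hε' i))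
  have hint : Integrable (fun y => ofPartials (T (w₀.1, w₀.2 - y) • g y)
      fun i => X i (w₀.1, w₀.2 - y) • g y) :=
    integrable_ofPartials (hT.integrable hg hw₀) fun i => (hX i).integrable hg hw₀
  unfold kernelConv
  rw [← integral_ofPartials (hT.integrable hg hw₀) fun i => (hX i).integrable hg hw₀]
  refine hasFDerivAt_integral_of_dominated_of_fderiv_le (𝕜 := ℝ)
    (F := fun w y => K (w.1, w.2 - y) • g y)
    (F' := fun w y => ofPartials (T (w.1, w.2 - y) • g y) fun i => X i (w.1, w.2 - y) • g y)
    (bound := fun y => C * ‖Real.exp (-c * ‖w₀.2 - y‖ ^ 2) • g y‖ +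
      ∑ i, C' i * ‖Real.exp (-c' i * ‖w₀.2 - y‖ ^ 2) • g y‖) hs ?_
    (h.integrable hg hw₀) hint.aestronglyMeasurable ?_ ?_ ?_
  · filter_upwards [hs] with w hw
    exact (h.integrable hg (hb w hw.1).1).aestronglyMeasurable
  · refine Filter.Eventually.of_forall fun y w hw => (norm_ofPartials_le _ _).trans ?_
    refine add_le_add ?_ (Finset.sum_le_sum fun i _ => ?_)
    · rw [norm_smul, norm_smul, ← mul_assoc, Real.norm_eq_abs, Real.norm_eq_abs, Real.abs_exp]
      exact mul_le_mul_of_nonneg_right ((hb w hw.1).2 y) (norm_nonneg _)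
    · rw [norm_smul, norm_smul, ← mul_assoc, Real.norm_eq_abs, Real.norm_eq_abs, Real.abs_exp]
      exact mul_le_mul_of_nonneg_right ((hb' i w (mem_iInter.1 hw.2 i)).2 y) (norm_nonneg _)
  · exact ((hg c hc w₀.2).norm.const_mul C).add
      (integrable_finsetSum _ fun i _ => (hg (c' i) (hc' i) w₀.2).norm.const_mul (C' i))
  · refine Filter.Eventually.of_forall fun y w hw => ?_
    have h1 : HasFDerivAt (fun w : ℝ × Rn n => (w.1, w.2 - y))
        (ContinuousLinearMap.id ℝ (ℝ × Rn n)) w := by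
      have := (hasFDerivAt_id (𝕜 := ℝ) w).sub_const ((0 : ℝ), y)
      refine this.congr_of_eventuallyEq (Filter.Eventually.of_forall fun w => ?_)
      ext <;> simp
    refine (((hd (w.1, w.2 - y) (hb w hw.1).1).comp w h1).smul_const (g y)).congr_fderiv ?_
    refine ContinuousLinearMap.ext fun v => ?_
    simp [ofPartials_apply, add_smul, Finset.sum_smul, mul_smul]

theorem isOpen_Ioi_prod : IsOpen (Ioi (0 : ℝ) ×ˢ (univ : Set (Rn n))) :=
  isOpen_Ioi.prod isOpen_univ

/-- The coefficients of the derivative are again kernel integrals of the same class, so induction on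
N works once m and K are generalized. -/
theorem IsHeatKernel.contDiffOn [CompleteSpace F] (N : ℕ) {m : ℕ} {K : ℝ × Rn n → ℝ}
    (h : IsHeatKernel n m K) {g : Rn n → F} (hg : GaussIntegrable g) :
    ContDiffOn ℝ N (kernelConv K g) (Ioi (0 : ℝ) ×ˢ (univ : Set (Rn n))) := by
  induction N generalizing m K with
  | zero =>
    obtain ⟨T, X, -, -, hd⟩ := h.exists_hasFDerivAt_kernelConv (F := F)
    refine contDiffOn_zero.2 fun z hz => ?_
    exact (hd g hg z hz.1).continuousAt.continuousWithinAt
  | succ N ih =>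
    obtain ⟨T, X, hT, hX, hd⟩ := h.exists_hasFDerivAt_kernelConv (F := F)
    push_cast
    refine (contDiffOn_succ_iff_hasFDerivWithinAt_of_uniqueDiffOn
      isOpen_Ioi_prod.uniqueDiffOn).2 ⟨by simp, _, ?_, fun z hz =>
        (hd g hg z hz.1).hasFDerivWithinAt⟩
    unfold ofPartials
    refine ((ContinuousLinearMap.smulRightL ℝ (ℝ × Rn n) F _).contDiff.comp_contDiffOn
      (ih hT)).add (ContDiffOn.sum fun i _ => ?_)
    exact (ContinuousLinearMap.smulRightL ℝ (ℝ × Rn n) F _).contDiff.comp_contDiffOn (ih (hX i))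

/-! ### Derivatives of the heat semigroup as kernel integrals. -/

theorem heat_eq_kernelConv {t : ℝ} (ht : 0 < t) (g : Rn n → F) (x : Rn n) :
    heat t g x = kernelConv (fun z => (4 * Real.pi) ^ (-((n : ℝ) / 2)) *
      (z.1 ^ (-((n : ℝ) / 2)) * Real.exp (-‖z.2‖ ^ 2 / (4 * z.1)))) g (t, x) := by
  unfold heat kernelConv
  rw [← integral_smul]
  congr 1
  funext y
  dsimp only
  rw [smul_smul, ← mul_assoc, ← Real.mul_rpow (by positivity) ht.le, one_div,
    Real.sqrt_eq_rpow, ← Real.rpow_natCast, ← Real.rpow_mul (by positivity),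
    ← Real.rpow_neg (by positivity)]
  congr 4
  ring

theorem isHeatKernel_heat : IsHeatKernel n 0 fun z => (4 * Real.pi) ^ (-((n : ℝ) / 2)) *
      (z.1 ^ (-((n : ℝ) / 2)) * Real.exp (-‖z.2‖ ^ 2 / (4 * z.1))) :=
  IsHeatKernel.gauss.const_mul _

theorem GaussIntegrable.heatSmooth [CompleteSpace F] {g : Rn n → F} (hg : GaussIntegrable g) :
    HeatSmooth g := by
  refine ⟨fun t ht x => ?_, contDiffOn_infty.2 fun N => ?_⟩
  · refine (hg (1 / (4 * t)) (by positivity) x).congr (Filter.Eventually.of_forall fun y => ?_)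
    have e : -(1 / (4 * t)) * ‖x - y‖ ^ 2 = -‖x - y‖ ^ 2 / (4 * t) := by ring
    simp only [e]
  · exact (isHeatKernel_heat.contDiffOn N hg).congr fun z hz => heat_eq_kernelConv hz.1 g z.2

theorem IsHeatKernel.exists_partialDeriv [CompleteSpace F] (h : IsHeatKernel n m K) (i : Fin n) :
    ∃ L, IsHeatKernel n (m + 1) L ∧ ∀ g : Rn n → F, GaussIntegrable g → ∀ t : ℝ, 0 < t →
      partialDeriv i (fun x => kernelConv K g (t, x)) = fun x => kernelConv L g (t, x) := by
  obtain ⟨T, X, hT, hX, hd⟩ := h.exists_hasFDerivAt_kernelConv (F := F)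
  refine ⟨X i, hX i, fun g hg t ht => funext fun x => ?_⟩
  have h1 := (hd g hg (t, x) ht).comp x (hasFDerivAt_prodMk_right (𝕜 := ℝ) t x)
  have h2 := (h1.hasLineDerivAt (EuclideanSpace.single i 1)).lineDeriv
  refine h2.trans ?_
  simp [ofPartials_apply]

theorem IsHeatKernel.exists_multiDeriv [CompleteSpace F] (l : List (Fin n)) (α : Fin n → ℕ)
    (h : IsHeatKernel n m K) :
    ∃ L, IsHeatKernel n (m + (l.map α).sum) L ∧ ∀ g : Rn n → F, GaussIntegrable g →
      ∀ t : ℝ, 0 < t → l.foldr (fun i h => (partialDeriv i)^[α i] h)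
        (fun x => kernelConv K g (t, x)) = fun x => kernelConv L g (t, x) := by
  induction l with
  | nil => exact ⟨K, by simpa using h, fun g hg t ht => rfl⟩
  | cons i l ih =>
    obtain ⟨L, hL, hLe⟩ := ih
    have key : ∀ N : ℕ, ∃ L', IsHeatKernel n (m + (l.map α).sum + N) L' ∧
        ∀ g : Rn n → F, GaussIntegrable g → ∀ t : ℝ, 0 < t →
        (partialDeriv i)^[N] (fun x => kernelConv L g (t, x)) =
          fun x => kernelConv L' g (t, x) := by
      intro N
      induction N with
      | zero => exact ⟨L, hL, fun g hg t ht => rfl⟩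
      | succ N ihN =>
        obtain ⟨L', hL', he'⟩ := ihN
        obtain ⟨L'', hL'', he''⟩ := hL'.exists_partialDeriv (F := F) i
        refine ⟨L'', hL'', fun g hg t ht => ?_⟩
        rw [Function.iterate_succ_apply', he' g hg t ht, he'' g hg t ht]
    obtain ⟨L', hL', he'⟩ := key (α i)
    refine ⟨L', ?_, fun g hg t ht => ?_⟩
    · convert hL' using 1
      simp only [List.map_cons, List.sum_cons]
      ring
    · rw [List.foldr_cons, hLe g hg t ht, he' g hg t ht]

theorem exists_heatDeriv_eq [CompleteSpace F] (k : ℕ) (α : Fin n → ℕ) :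
    ∃ L, IsHeatKernel n (2 * k + ∑ i, α i) L ∧ ∀ g : Rn n → F, GaussIntegrable g →
      ∀ t : ℝ, 0 < t → ∀ x, heatDeriv k α t g x = kernelConv L g (t, x) := by
  induction k with
  | zero =>
    obtain ⟨L, hL, he⟩ := isHeatKernel_heat.exists_multiDeriv (F := F) (List.finRange n) α
    refine ⟨L, by simpa [← List.ofFn_eq_map, List.sum_ofFn] using hL, fun g hg t ht x => ?_⟩
    simp only [heatDeriv, iteratedDeriv_zero, multiDeriv]
    rw [← congrFun (he g hg t ht) x]
    rw [show heat t g = _ from funext fun x => heat_eq_kernelConv ht g x]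
  | succ k ih =>
    obtain ⟨L, hL, he⟩ := ih
    obtain ⟨T, X, hT, -, hd⟩ := hL.exists_hasFDerivAt_kernelConv (F := F)
    refine ⟨T, ?_, fun g hg t ht x => ?_⟩
    · convert hT using 1
      ring
    have h1 := ((hd g hg (t, x) ht).comp t (hasFDerivAt_prodMk_left (𝕜 := ℝ) t x)).hasDerivAt
    -- The kernel formula is available only for positive times, hence equality near t rather than
    -- everywhere.
    have h2 : (fun τ => heatDeriv k α τ g x) =ᶠ[nhds t] fun τ => kernelConv L g (τ, x) := by
      filter_upwards [lt_mem_nhds ht] with τ hτ using he g hg τ hτ x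
    have h3 := (h1.congr_of_eventuallyEq h2).deriv
    rw [heatDeriv, iteratedDeriv_succ]
    refine h3.trans ?_
    simp [ofPartials_apply]

end Smooth

/-! ### Integral inequalities -/

/-- Hölder against the constant 1. The measure is left general because it is applied both to
Lebesgue measure on a ball and to k(x - y) dy. -/
theorem lintegral_rpow_le_rpow_lintegral_rpow {X : Type*} [MeasurableSpace X] {μ : Measure X}
    {H : X → ℝ≥0∞} (hH : AEMeasurable H μ) {θ q : ℝ} (hθ : 0 < θ) (hθq : θ ≤ q) :
    ∫⁻ x, H x ^ θ ∂μ ≤ (∫⁻ x, H x ^ q ∂μ) ^ (θ / q) * μ univ ^ (1 - θ / q) := by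
  have h := eLpNorm'_le_eLpNorm'_mul_rpow_measure_univ hθ hθq hH.aestronglyMeasurable
  have h2 := ENNReal.rpow_le_rpow h hθ.le
  rw [ENNReal.mul_rpow_of_nonneg _ _ hθ.le, ← lintegral_rpow_enorm_eq_rpow_eLpNorm' hθ,
    eLpNorm'_eq_lintegral_enorm, ← ENNReal.rpow_mul, ← ENNReal.rpow_mul] at h2
  simp only [enorm_eq_self] at h2
  convert h2 using 3
  · ring
  · field_simp

theorem lintegral_Ioc_rpow {e R : ℝ} (he : -1 < e) (hR : 0 < R) :
    ∫⁻ t in Ioc 0 R, ENNReal.ofReal (t ^ e) = ENNReal.ofReal (R ^ (e + 1) / (e + 1)) := by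
  have h := intervalIntegral.intervalIntegrable_rpow' (a := 0) (b := R) he
  rw [intervalIntegrable_iff_integrableOn_Ioc_of_le hR.le] at h
  rw [← ofReal_integral_eq_lintegral_ofReal h, ← intervalIntegral.integral_of_le hR.le,
    integral_rpow (Or.inl he), Real.zero_rpow (by linarith), sub_zero]
  exact (ae_restrict_iff' measurableSet_Ioc).2
    (Filter.Eventually.of_forall fun t ht => Real.rpow_nonneg ht.1.le _)

theorem lintegral_Ioi_rpow {e R : ℝ} (he : e < -1) (hR : 0 < R) :
    ∫⁻ t in Ioi R, ENNReal.ofReal (t ^ e) = ENNReal.ofReal (-R ^ (e + 1) / (e + 1)) := by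
  rw [← ofReal_integral_eq_lintegral_ofReal (integrableOn_Ioi_rpow_of_lt he hR),
    integral_Ioi_rpow_of_lt he hR]
  exact (ae_restrict_iff' measurableSet_Ioi).2
    (Filter.Eventually.of_forall fun t ht => Real.rpow_nonneg (hR.trans ht).le _)

theorem ofReal_norm_rpow_neg_le {E : Type*} [NormedAddCommGroup E] {a : ℝ} (ha : 0 < a) (y : E) :
    ENNReal.ofReal (‖y‖ ^ (-a)) ≤
      ENNReal.ofReal a * ∫⁻ ρ in Ioi ‖y‖, ENNReal.ofReal (ρ ^ (-a - 1)) := by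
  rcases (norm_nonneg y).eq_or_lt with h | h
  -- At y = 0 the real power takes the value 0, so only an inequality is claimed.
  · rw [← h, Real.zero_rpow (by linarith)]
    simp
  · rw [lintegral_Ioi_rpow (by linarith) h, ← ENNReal.ofReal_mul ha.le]
    refine ENNReal.ofReal_le_ofReal (le_of_eq ?_)
    rw [show -a - 1 + 1 = -a by ring]
    field_simp

/-- Layer-cake formula and Tonelli: a power weight is controlled through the masses of centred
balls, which is exactly what a Morrey norm bounds. -/
theorem lintegral_norm_rpow_neg_mul_le {E : Type*} [NormedAddCommGroup E] [MeasurableSpace E]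
    [OpensMeasurableSpace E] {μ : Measure E} [SFinite μ] {H : E → ℝ≥0∞}
    (hH : AEMeasurable H μ) {a : ℝ} (ha : 0 < a) :
    ∫⁻ y, ENNReal.ofReal (‖y‖ ^ (-a)) * H y ∂μ ≤
      ENNReal.ofReal a * ∫⁻ ρ in Ioi (0 : ℝ), ENNReal.ofReal (ρ ^ (-a - 1)) *
        ∫⁻ y in Metric.ball 0 ρ, H y ∂μ := by
  have hm : Measurable fun ρ : ℝ => ENNReal.ofReal (ρ ^ (-a - 1)) :=
    (Measurable.pow_const measurable_id _).ennreal_ofReal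
  have hS : MeasurableSet {z : E × ℝ | ‖z.1‖ < z.2} :=
    measurableSet_lt measurable_fst.norm measurable_snd
  calc ∫⁻ y, ENNReal.ofReal (‖y‖ ^ (-a)) * H y ∂μ
      ≤ ∫⁻ y, (ENNReal.ofReal a * ∫⁻ ρ in Ioi (0 : ℝ),
          {z : E × ℝ | ‖z.1‖ < z.2}.indicator
            (fun z => ENNReal.ofReal (z.2 ^ (-a - 1)) * H z.1) (y, ρ)) ∂μ := by
        refine lintegral_mono fun y => ?_
        refine (mul_le_mul_left (ofReal_norm_rpow_neg_le ha y) _).trans ?_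
        rw [mul_assoc, ← lintegral_mul_const _ hm]
        refine mul_le_mul_right ?_ _
        rw [← lintegral_indicator measurableSet_Ioi, ← lintegral_indicator measurableSet_Ioi]
        refine lintegral_mono fun ρ => ?_
        by_cases h : ‖y‖ < ρ
        · simp [indicator, h, (norm_nonneg y).trans_lt h]
        · simp [indicator, h]
    _ = ENNReal.ofReal a * ∫⁻ ρ in Ioi (0 : ℝ), ∫⁻ y,
          {z : E × ℝ | ‖z.1‖ < z.2}.indicator
            (fun z => ENNReal.ofReal (z.2 ^ (-a - 1)) * H z.1) (y, ρ) ∂μ := by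
        have hae : AEMeasurable ({z : E × ℝ | ‖z.1‖ < z.2}.indicator
            (fun z => ENNReal.ofReal (z.2 ^ (-a - 1)) * H z.1))
            (μ.prod (volume.restrict (Ioi 0))) :=
          (((hm.comp measurable_snd).aemeasurable).mul
            (hH.comp_quasiMeasurePreserving Measure.quasiMeasurePreserving_fst)).indicator hS
        rw [lintegral_const_mul' _ _ ENNReal.ofReal_ne_top, lintegral_lintegral_swap (f := fun y ρ =>
            {z : E × ℝ | ‖z.1‖ < z.2}.indicator
              (fun z => ENNReal.ofReal (z.2 ^ (-a - 1)) * H z.1) (y, ρ)) hae]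
    _ = _ := by
        congr 1
        refine lintegral_congr fun ρ => ?_
        rw [← lintegral_const_mul' _ _ ENNReal.ofReal_ne_top,
          ← lintegral_indicator Metric.isOpen_ball.measurableSet]
        refine lintegral_congr fun y => ?_
        simp [indicator]

theorem setLIntegral_ball_norm_rpow_neg_mul_le {E : Type*} [NormedAddCommGroup E]
    [MeasurableSpace E] [OpensMeasurableSpace E] {μ : Measure E} [SFinite μ] {H : E → ℝ≥0∞}
    (hH : AEMeasurable H μ) {a d : ℝ} (ha : 0 < a) (had : a < d) {N : ℝ≥0∞} {R : ℝ} (hR : 0 < R)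
    (h : ∀ ρ : ℝ, 0 < ρ → ∫⁻ y in Metric.ball 0 ρ, H y ∂μ ≤ ENNReal.ofReal (ρ ^ d) * N) :
    ∫⁻ y in Metric.ball 0 R, ENNReal.ofReal (‖y‖ ^ (-a)) * H y ∂μ ≤
      ENNReal.ofReal (d / (d - a)) * (ENNReal.ofReal (R ^ (d - a)) * N) := by
  refine (lintegral_norm_rpow_neg_mul_le hH.restrict ha).trans ?_
  have hd : 0 < d - a := by linarith
  have hm : Measurable fun ρ : ℝ => ENNReal.ofReal (ρ ^ (-a - 1)) :=
    (Measurable.pow_const measurable_id _).ennreal_ofReal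
  have hm' : Measurable fun ρ : ℝ => ENNReal.ofReal (ρ ^ (d - a - 1)) :=
    (Measurable.pow_const measurable_id _).ennreal_ofReal
  rw [← Ioc_union_Ioi_eq_Ioi hR.le, lintegral_union measurableSet_Ioi
    (Ioc_disjoint_Ioi le_rfl)]
  have h1 : ∫⁻ ρ in Ioc 0 R, ENNReal.ofReal (ρ ^ (-a - 1)) *
      ∫⁻ y in Metric.ball 0 ρ, H y ∂μ.restrict (Metric.ball 0 R) ≤
      ENNReal.ofReal (R ^ (d - a) / (d - a)) * N := by
    rw [show d - a = d - a - 1 + 1 by ring, ← lintegral_Ioc_rpow (by linarith) hR,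
      ← lintegral_mul_const _ hm']
    refine setLIntegral_mono' measurableSet_Ioc fun ρ hρ => ?_
    refine (mul_le_mul_right ((lintegral_mono' (Measure.restrict_mono_measure
      Measure.restrict_le_self _) le_rfl).trans (h ρ hρ.1)) _).trans_eq ?_
    rw [← mul_assoc, ← ENNReal.ofReal_mul (Real.rpow_nonneg hρ.1.le _), ← Real.rpow_add hρ.1]
    congr 3
    ring
  -- Beyond R the ball mass no longer grows, as only B(0, R) is integrated over. Altogether a(1/(d -
  -- a) + 1/a) = d/(d - a).
  have h2 : ∫⁻ ρ in Ioi R, ENNReal.ofReal (ρ ^ (-a - 1)) *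
      ∫⁻ y in Metric.ball 0 ρ, H y ∂μ.restrict (Metric.ball 0 R) ≤
      ENNReal.ofReal (R ^ (d - a) / a) * N := by
    calc _ ≤ ∫⁻ ρ in Ioi R, ENNReal.ofReal (ρ ^ (-a - 1)) * (ENNReal.ofReal (R ^ d) * N) := by
          refine lintegral_mono fun ρ => ?_
          refine mul_le_mul_right ((lintegral_mono' Measure.restrict_le_self le_rfl).trans
            (h R hR)) _
      _ = _ := by
          rw [lintegral_mul_const _ hm, lintegral_Ioi_rpow (by linarith) hR, ← mul_assoc,
            ← ENNReal.ofReal_mul' (Real.rpow_nonneg hR.le _)]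
          congr 2
          rw [show -a - 1 + 1 = -a by ring, show d - a = -a + d by ring, Real.rpow_add hR]
          field_simp
  refine (mul_le_mul_right (add_le_add h1 h2) _).trans_eq ?_
  have hRp := Real.rpow_nonneg hR.le (d - a)
  rw [← add_mul, ← ENNReal.ofReal_add (by positivity) (by positivity), ← mul_assoc, ← mul_assoc,
    ← ENNReal.ofReal_mul ha.le, ← ENNReal.ofReal_mul (div_nonneg (by linarith) hd.le)]
  congr 2
  field_simp
  ring

theorem setLIntegral_compl_ball_norm_rpow_neg_mul_le {E : Type*} [NormedAddCommGroup E]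
    [MeasurableSpace E] [OpensMeasurableSpace E] {μ : Measure E} [SFinite μ] {H : E → ℝ≥0∞}
    (hH : AEMeasurable H μ) {a d : ℝ} (ha : 0 < a) (had : d < a) {N : ℝ≥0∞} {R : ℝ} (hR : 0 < R)
    (h : ∀ ρ : ℝ, 0 < ρ → ∫⁻ y in Metric.ball 0 ρ, H y ∂μ ≤ ENNReal.ofReal (ρ ^ d) * N) :
    ∫⁻ y in (Metric.ball 0 R)ᶜ, ENNReal.ofReal (‖y‖ ^ (-a)) * H y ∂μ ≤
      ENNReal.ofReal (a / (a - d)) * (ENNReal.ofReal (R ^ (d - a)) * N) := by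
  refine (lintegral_norm_rpow_neg_mul_le hH.restrict ha).trans ?_
  have hd : 0 < a - d := by linarith
  have hm' : Measurable fun ρ : ℝ => ENNReal.ofReal (ρ ^ (d - a - 1)) :=
    (Measurable.pow_const measurable_id _).ennreal_ofReal
  rw [← Ioc_union_Ioi_eq_Ioi hR.le, lintegral_union measurableSet_Ioi
    (Ioc_disjoint_Ioi le_rfl)]
  -- Balls of radius at most R miss the region of integration, so only large radii count, where d <
  -- a gives convergence.
  have h1 : ∫⁻ ρ in Ioc 0 R, ENNReal.ofReal (ρ ^ (-a - 1)) *
      ∫⁻ y in Metric.ball 0 ρ, H y ∂μ.restrict (Metric.ball 0 R)ᶜ = 0 := by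
    rw [setLIntegral_congr_fun (g := fun _ => 0) measurableSet_Ioc fun ρ hρ => ?_, lintegral_zero]
    dsimp only
    rw [Measure.restrict_restrict Metric.isOpen_ball.measurableSet,
      show Metric.ball (0 : E) ρ ∩ (Metric.ball 0 R)ᶜ = ∅ from
        (disjoint_compl_right.mono_left (Metric.ball_subset_ball hρ.2)).inter_eq]
    simp
  have h2 : ∫⁻ ρ in Ioi R, ENNReal.ofReal (ρ ^ (-a - 1)) *
      ∫⁻ y in Metric.ball 0 ρ, H y ∂μ.restrict (Metric.ball 0 R)ᶜ ≤
      ENNReal.ofReal (R ^ (d - a) / (a - d)) * N := by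
    have e : R ^ (d - a) / (a - d) = -R ^ (d - a - 1 + 1) / (d - a - 1 + 1) := by
      rw [show d - a - 1 + 1 = d - a by ring, neg_div, ← div_neg, neg_sub]
    rw [e, ← lintegral_Ioi_rpow (by linarith) hR, ← lintegral_mul_const _ hm']
    refine setLIntegral_mono' measurableSet_Ioi fun ρ hρ => ?_
    have hρ0 : 0 < ρ := hR.trans hρ
    refine (mul_le_mul_right ((lintegral_mono' (Measure.restrict_mono_measure
      Measure.restrict_le_self _) le_rfl).trans (h ρ hρ0)) _).trans_eq ?_
    rw [← mul_assoc, ← ENNReal.ofReal_mul (Real.rpow_nonneg hρ0.le _), ← Real.rpow_add hρ0]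
    congr 3
    ring
  rw [h1, zero_add]
  refine (mul_le_mul_right h2 _).trans_eq ?_
  rw [← mul_assoc, ← mul_assoc, ← ENNReal.ofReal_mul ha.le,
    ← ENNReal.ofReal_mul (div_nonneg ha.le hd.le)]
  congr 2
  field_simp

/-! ### Convolution with a bounded integrable kernel -/

section Convolution

variable {n : ℕ} {k H : Rn n → ℝ≥0∞}

theorem aemeasurable_uncurry_conv (hk : Measurable k) (hH : AEMeasurable H) :
    AEMeasurable (Function.uncurry fun x y : Rn n => k (x - y) * H y)
      ((volume : Measure (Rn n)).prod volume) :=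
  (hk.comp (measurable_fst.sub measurable_snd)).aemeasurable.mul
    (hH.comp_quasiMeasurePreserving Measure.quasiMeasurePreserving_snd)

theorem lintegral_conv_le_of_le {S : ℝ≥0∞} (hS : ∀ x, k x ≤ S) (hH : AEMeasurable H) (x : Rn n) :
    ∫⁻ y, k (x - y) * H y ≤ S * ∫⁻ y, H y := by
  rw [← lintegral_const_mul'' _ hH]
  exact lintegral_mono fun y => mul_le_mul_left (hS _) _

theorem lintegral_lintegral_conv (hk : Measurable k) (hH : AEMeasurable H) :
    ∫⁻ x, ∫⁻ y, k (x - y) * H y = (∫⁻ x, k x) * ∫⁻ y, H y := by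
  rw [lintegral_lintegral_swap (aemeasurable_uncurry_conv hk hH), ← lintegral_const_mul'' _ hH]
  refine lintegral_congr fun y => ?_
  have h1 : Measurable fun x : Rn n => k (x - y) := by fun_prop
  rw [lintegral_mul_const _ h1, lintegral_sub_right_eq_self]

/-- Jensen's inequality for the measure k(x - y) dy, whose total mass is ∫ k for every x. -/
theorem lintegral_conv_rpow_le (hk : Measurable k) (hH : AEMeasurable H) {θ : ℝ} (hθ : 1 ≤ θ)
    (x : Rn n) :
    (∫⁻ y, k (x - y) * H y) ^ θ ≤ (∫⁻ y, k y) ^ (θ - 1) * ∫⁻ y, k (x - y) * H y ^ θ := by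
  have hk' : Measurable fun y => k (x - y) := by fun_prop
  have hH' : AEMeasurable H (volume.withDensity fun y => k (x - y)) :=
    hH.mono_ac (withDensity_absolutelyContinuous _ _)
  have h := lintegral_rpow_le_rpow_lintegral_rpow hH' one_pos hθ
  have hθ0 : 0 < θ := by linarith
  simp only [ENNReal.rpow_one] at h
  rw [withDensity_apply _ MeasurableSet.univ, Measure.restrict_univ, lintegral_sub_left_eq_self,
    lintegral_withDensity_eq_lintegral_mul₀ hk'.aemeasurable hH,
    lintegral_withDensity_eq_lintegral_mul₀ hk'.aemeasurable (hH.pow_const θ)] at h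
  refine (ENNReal.rpow_le_rpow h hθ0.le).trans_eq ?_
  rw [ENNReal.mul_rpow_of_nonneg _ _ hθ0.le, ← ENNReal.rpow_mul, ← ENNReal.rpow_mul,
    one_div_mul_cancel hθ0.ne', ENNReal.rpow_one, mul_comm, sub_mul, one_div_mul_cancel hθ0.ne',
    one_mul]
  rfl

/-- If `H` splits into a part in `L¹` and a part in `L^θ`, then its convolution with a bounded
integrable kernel lies in `L^θ ∩ L^∞`. -/
theorem exists_conv_bound {θ : ℝ} (hθ : 1 ≤ θ) {Q C₁ C₂ : ℝ≥0∞} (hQ : Q ≠ ⊤) (hC₁ : C₁ ≠ ⊤)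
    (hC₂ : C₂ ≠ ⊤) :
    ∃ D : ℝ≥0∞, D ≠ ⊤ ∧ 1 ≤ D ∧ ∀ (S V X : ℝ≥0∞) (k H : Rn n → ℝ≥0∞) (A : Set (Rn n)),
      Measurable k → AEMeasurable H → MeasurableSet A → S * V = 1 → (∀ x, k x ≤ S) →
      ∫⁻ x, k x = Q → ∫⁻ y in A, H y ≤ C₁ * (V * X) →
      ∫⁻ y in Aᶜ, H y ^ θ ≤ C₂ * (V * X ^ θ) →
      (∀ x, ∫⁻ y, k (x - y) * H y ≤ D * X) ∧
      ∫⁻ x, (∫⁻ y, k (x - y) * H y) ^ θ ≤ D * (V * X ^ θ) := by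
  have hθ0 : 0 < θ := by linarith
  have hθ1 : 0 ≤ θ - 1 := by linarith
  -- D₁ controls the supremum of the convolution of the L^θ part; D₂ controls the integral of the
  -- θ-th power of the whole convolution.
  set D₁ : ℝ≥0∞ := (Q ^ (θ - 1) * C₂) ^ (1 / θ)
  set D₂ : ℝ≥0∞ := 2 ^ (θ - 1) * (C₁ ^ (θ - 1) * (Q * C₁) + Q ^ (θ - 1) * (Q * C₂))
  have t1 : Q ^ (θ - 1) ≠ ⊤ := ENNReal.rpow_ne_top_of_nonneg hθ1 hQ
  have t2 : C₁ ^ (θ - 1) ≠ ⊤ := ENNReal.rpow_ne_top_of_nonneg hθ1 hC₁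
  have t3 : (2 : ℝ≥0∞) ^ (θ - 1) ≠ ⊤ := ENNReal.rpow_ne_top_of_nonneg hθ1 (by simp)
  have t4 : D₁ ≠ ⊤ := ENNReal.rpow_ne_top_of_nonneg (by positivity) (ENNReal.mul_ne_top t1 hC₂)
  have t5 : D₂ ≠ ⊤ := by finiteness
  -- D is fixed before the height S, the volume V and the amplitude X, which will carry all
  -- dependence on t and f.
  refine ⟨1 + (C₁ + D₁) + D₂, by finiteness, by rw [add_assoc]; exact le_self_add, ?_⟩
  intro S V X k H A hk hH hA hSV hS hkQ h1 h2
  have hH0 : AEMeasurable (A.indicator H) := hH.indicator hA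
  have hH1 : AEMeasurable (Aᶜ.indicator H) := hH.indicator hA.compl
  have hH1' : AEMeasurable fun y => Aᶜ.indicator H y ^ θ := hH1.pow_const θ
  have e1 : ∫⁻ y, A.indicator H y = ∫⁻ y in A, H y := lintegral_indicator hA _
  have e2 : ∫⁻ y, Aᶜ.indicator H y ^ θ = ∫⁻ y in Aᶜ, H y ^ θ := by
    rw [← lintegral_indicator hA.compl]
    refine lintegral_congr fun y => ?_
    by_cases hy : y ∈ Aᶜ <;> simp [indicator, hθ0]
  have hsplit : ∀ x, ∫⁻ y, k (x - y) * H y = (∫⁻ y, k (x - y) * A.indicator H y) +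
      ∫⁻ y, k (x - y) * Aᶜ.indicator H y := by
    intro x
    have hk' : Measurable fun y => k (x - y) := by fun_prop
    have hm : AEMeasurable fun y => k (x - y) * A.indicator H y := hk'.aemeasurable.mul hH0
    rw [← lintegral_add_left' hm]
    refine lintegral_congr fun y => ?_
    rw [← mul_add]
    congr 1
    exact (congrFun (indicator_self_add_compl A H) y).symm
  have b0 : ∀ x, ∫⁻ y, k (x - y) * A.indicator H y ≤ C₁ * X := fun x => by
    refine (lintegral_conv_le_of_le hS hH0 x).trans ?_
    rw [e1]
    refine (mul_le_mul_right h1 _).trans_eq ?_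
    calc S * (C₁ * (V * X)) = (S * V) * (C₁ * X) := by ring
      _ = _ := by rw [hSV, one_mul]
  have b1' : ∀ x, (∫⁻ y, k (x - y) * Aᶜ.indicator H y) ^ θ ≤ (Q ^ (θ - 1) * C₂) * X ^ θ :=
    fun x => by
    refine (lintegral_conv_rpow_le hk hH1 hθ x).trans ?_
    rw [hkQ]
    refine (mul_le_mul_right ((lintegral_conv_le_of_le hS hH1' x).trans
      (mul_le_mul_right (e2.trans_le h2) _)) _).trans_eq ?_
    calc Q ^ (θ - 1) * (S * (C₂ * (V * X ^ θ))) = (S * V) * (Q ^ (θ - 1) * C₂ * X ^ θ) := by ring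
      _ = _ := by rw [hSV, one_mul]
  have b1 : ∀ x, ∫⁻ y, k (x - y) * Aᶜ.indicator H y ≤ D₁ * X := fun x => by
    rw [← ENNReal.rpow_le_rpow_iff hθ0, ENNReal.mul_rpow_of_nonneg _ _ hθ0.le, ← ENNReal.rpow_mul,
      one_div_mul_cancel hθ0.ne', ENNReal.rpow_one]
    exact b1' x
  constructor
  · intro x
    rw [hsplit]
    refine (add_le_add (b0 x) (b1 x)).trans ?_
    rw [← add_mul]
    refine mul_le_mul_left ?_ _
    rw [add_right_comm]
    exact le_add_self
  · have hm0 : AEMeasurable fun x => ∫⁻ y, k (x - y) * A.indicator H y :=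
      (aemeasurable_uncurry_conv hk hH0).lintegral_prod_right'
    have hm1 : AEMeasurable fun x => ∫⁻ y, k (x - y) * Aᶜ.indicator H y :=
      (aemeasurable_uncurry_conv hk hH1).lintegral_prod_right'
    -- For the L¹ part, u^θ ≤ (sup u)^{θ-1} u reduces to Tonelli; the L^θ part below uses Jensen
    -- first.
    have i0 : ∫⁻ x, (∫⁻ y, k (x - y) * A.indicator H y) ^ θ ≤
        C₁ ^ (θ - 1) * (Q * C₁) * (V * X ^ θ) := by
      calc ∫⁻ x, (∫⁻ y, k (x - y) * A.indicator H y) ^ θ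
          ≤ ∫⁻ x, (C₁ * X) ^ (θ - 1) * ∫⁻ y, k (x - y) * A.indicator H y := by
            refine lintegral_mono fun x => ?_
            calc (∫⁻ y, k (x - y) * A.indicator H y) ^ θ
                = (∫⁻ y, k (x - y) * A.indicator H y) ^ (θ - 1) *
                    ∫⁻ y, k (x - y) * A.indicator H y := by
                  conv_rhs => rw [← ENNReal.rpow_one (∫⁻ y, k (x - y) * A.indicator H y),
                    ← ENNReal.rpow_mul, one_mul, ← ENNReal.rpow_add_of_nonneg _ _ hθ1 zero_le_one,
                    sub_add_cancel]
              _ ≤ _ := mul_le_mul_left (ENNReal.rpow_le_rpow (b0 x) hθ1) _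
        _ = (C₁ * X) ^ (θ - 1) * (Q * ∫⁻ y in A, H y) := by
            rw [lintegral_const_mul'' _ hm0, lintegral_lintegral_conv hk hH0, hkQ, e1]
        _ ≤ (C₁ * X) ^ (θ - 1) * (Q * (C₁ * (V * X))) := by gcongr
        _ = C₁ ^ (θ - 1) * (Q * C₁) * (V * (X ^ (θ - 1) * X)) := by
            rw [ENNReal.mul_rpow_of_nonneg _ _ hθ1]
            ring
        _ = _ := by
            congr 2
            nth_rewrite 2 [← ENNReal.rpow_one X]
            rw [← ENNReal.rpow_add_of_nonneg _ _ hθ1 zero_le_one, sub_add_cancel]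
    have i1 : ∫⁻ x, (∫⁻ y, k (x - y) * Aᶜ.indicator H y) ^ θ ≤
        Q ^ (θ - 1) * (Q * C₂) * (V * X ^ θ) := by
      calc ∫⁻ x, (∫⁻ y, k (x - y) * Aᶜ.indicator H y) ^ θ
          ≤ ∫⁻ x, Q ^ (θ - 1) * ∫⁻ y, k (x - y) * Aᶜ.indicator H y ^ θ :=
            lintegral_mono fun x => hkQ ▸ lintegral_conv_rpow_le hk hH1 hθ x
        _ = Q ^ (θ - 1) * (Q * ∫⁻ y in Aᶜ, H y ^ θ) := by
            rw [lintegral_const_mul' _ _ t1, lintegral_lintegral_conv hk hH1', hkQ, e2]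
        _ ≤ Q ^ (θ - 1) * (Q * (C₂ * (V * X ^ θ))) := by gcongr
        _ = _ := by ring
    calc ∫⁻ x, (∫⁻ y, k (x - y) * H y) ^ θ
        ≤ ∫⁻ x, 2 ^ (θ - 1) * ((∫⁻ y, k (x - y) * A.indicator H y) ^ θ +
            (∫⁻ y, k (x - y) * Aᶜ.indicator H y) ^ θ) := by
          refine lintegral_mono fun x => ?_
          simp only [hsplit x]
          exact ENNReal.rpow_add_le_mul_rpow_add_rpow _ _ hθ
      _ = 2 ^ (θ - 1) * ((∫⁻ x, (∫⁻ y, k (x - y) * A.indicator H y) ^ θ) +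
            ∫⁻ x, (∫⁻ y, k (x - y) * Aᶜ.indicator H y) ^ θ) := by
          rw [lintegral_const_mul' _ _ t3, lintegral_add_left' (hm0.pow_const θ)]
      _ ≤ 2 ^ (θ - 1) * (C₁ ^ (θ - 1) * (Q * C₁) * (V * X ^ θ) +
            Q ^ (θ - 1) * (Q * C₂) * (V * X ^ θ)) := by gcongr
      _ = D₂ * (V * X ^ θ) := by
          simp only [D₂]
          ring
      _ ≤ _ := mul_le_mul_left le_add_self _

end Convolution

/-! ### Interpolation between `L^θ` and `L^∞` -/

section Interpolation

variable {n : ℕ} {F : Type*} [NormedAddCommGroup F] {h : Rn n → F}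

/-- Uses |h|^s ≤ A^{s-θ}|h|^θ. Here W acts as an effective measure of support: h is treated like A
times the indicator of a set of measure W. -/
theorem eLpNorm_le_of_bounded {θ s : ℝ} (hθ : 0 < θ) (hθs : θ < s) {A W : ℝ≥0∞}
    (hA : ∀ x, ‖h x‖ₑ ≤ A) (hAt : A ≠ ⊤) (hW : ∫⁻ x, ‖h x‖ₑ ^ θ ≤ A ^ θ * W) :
    eLpNorm h (ENNReal.ofReal s) volume ≤ A * W ^ (1 / s) := by
  have hs : 0 < s := hθ.trans hθs
  have hd : 0 ≤ s - θ := by linarith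
  rw [eLpNorm_eq_lintegral_rpow_enorm_toReal (by simpa using hs) ENNReal.ofReal_ne_top,
    ENNReal.toReal_ofReal hs.le]
  have h1 : ∫⁻ x, ‖h x‖ₑ ^ s ≤ A ^ s * W := by
    calc ∫⁻ x, ‖h x‖ₑ ^ s ≤ ∫⁻ x, A ^ (s - θ) * ‖h x‖ₑ ^ θ := by
          refine lintegral_mono fun x => ?_
          rw [show ‖h x‖ₑ ^ s = ‖h x‖ₑ ^ (s - θ) * ‖h x‖ₑ ^ θ by
            rw [← ENNReal.rpow_add_of_nonneg _ _ hd hθ.le, sub_add_cancel]]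
          exact mul_le_mul_left (ENNReal.rpow_le_rpow (hA x) hd) _
      _ = A ^ (s - θ) * ∫⁻ x, ‖h x‖ₑ ^ θ :=
          lintegral_const_mul' _ _ (ENNReal.rpow_ne_top_of_nonneg hd hAt)
      _ ≤ A ^ (s - θ) * (A ^ θ * W) := mul_le_mul_right hW _
      _ = _ := by
          rw [← mul_assoc, ← ENNReal.rpow_add_of_nonneg _ _ hd hθ.le, sub_add_cancel]
  refine (ENNReal.rpow_le_rpow h1 (by positivity)).trans_eq ?_
  rw [ENNReal.mul_rpow_of_nonneg _ _ (by positivity), ← ENNReal.rpow_mul, mul_one_div_cancel hs.ne',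
    ENNReal.rpow_one]

/-- Chebyshev with exponent θ below the height a; above it the level sets are empty. -/
theorem ofReal_mul_volume_lt_norm_le (hm : AEStronglyMeasurable h volume) {θ s : ℝ} (hθ : 0 < θ)
    (hs : 0 < s) {a : ℝ} (ha : 0 ≤ a) {W : ℝ≥0∞} (hA : ∀ x, ‖h x‖ ≤ a)
    (hW : ∫⁻ x, ‖h x‖ₑ ^ θ ≤ ENNReal.ofReal a ^ θ * W) {t : ℝ} (ht : 0 < t) :
    ENNReal.ofReal t * volume {x | t < ‖h x‖} ^ (1 / s) ≤
      if t < a then ENNReal.ofReal (t ^ (1 - θ / s) * a ^ (θ / s)) * W ^ (1 / s) else 0 := by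
  split_ifs with hta
  · have h0 : volume {x | t < ‖h x‖} ≤ ENNReal.ofReal ((a / t) ^ θ) * W := by
      have h1 := mul_meas_ge_le_lintegral₀ (hm.enorm.pow_const θ) (ENNReal.ofReal (t ^ θ))
      have h2 : volume {x | t < ‖h x‖} ≤
          volume {x | ENNReal.ofReal (t ^ θ) ≤ ‖h x‖ₑ ^ θ} := by
        refine measure_mono fun x hx => ?_
        simp only [mem_ofPred_eq] at hx ⊢
        rw [← ofReal_norm, ENNReal.ofReal_rpow_of_nonneg (norm_nonneg _) hθ.le]
        exact ENNReal.ofReal_le_ofReal (Real.rpow_le_rpow ht.le hx.le hθ.le)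
      have h3 : ENNReal.ofReal (t ^ θ) * volume {x | t < ‖h x‖} ≤ ENNReal.ofReal (a ^ θ) * W := by
        rw [← ENNReal.ofReal_rpow_of_nonneg ha hθ.le]
        exact ((mul_le_mul_right h2 _).trans h1).trans hW
      have htθ : 0 < t ^ θ := Real.rpow_pos_of_pos ht _
      calc volume {x | t < ‖h x‖}
          = ENNReal.ofReal ((t ^ θ)⁻¹) * (ENNReal.ofReal (t ^ θ) * volume {x | t < ‖h x‖}) := by
            rw [← mul_assoc, ← ENNReal.ofReal_mul (by positivity), inv_mul_cancel₀ htθ.ne']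
            simp
        _ ≤ ENNReal.ofReal ((t ^ θ)⁻¹) * (ENNReal.ofReal (a ^ θ) * W) := mul_le_mul_right h3 _
        _ = _ := by
            rw [← mul_assoc, ← ENNReal.ofReal_mul (by positivity), Real.div_rpow ha ht.le,
              div_eq_inv_mul]
    refine (mul_le_mul_right (ENNReal.rpow_le_rpow h0 (by positivity)) _).trans_eq ?_
    rw [ENNReal.mul_rpow_of_nonneg _ _ (by positivity),
      ENNReal.ofReal_rpow_of_nonneg (by positivity) (by positivity), ← mul_assoc,
      ← ENNReal.ofReal_mul ht.le, ← Real.rpow_mul (by positivity), mul_one_div,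
      Real.div_rpow ha ht.le, Real.rpow_sub ht, Real.rpow_one]
    congr 2
    ring
  · have : {x | t < ‖h x‖} = ∅ := by
      ext x
      simpa using (hA x).trans (not_lt.1 hta)
    rw [this, measure_empty, ENNReal.zero_rpow_of_pos (by positivity), mul_zero]

/-- The level-set bound grows like t^{1-θ/s} and is cut off at height a. As θ < s the exponent is
positive, so the dt/t integral converges at 0 for every finite r; r affects only the constant. -/
theorem exists_lorentzNorm_le_of_bounded {θ s : ℝ} (hθ : 0 < θ) (hθs : θ < s) {r : ℝ≥0∞}
    (hr : 1 ≤ r) : ∃ C : ℝ≥0∞, C ≠ ⊤ ∧ ∀ (h : Rn n → F) (A W : ℝ≥0∞),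
      AEStronglyMeasurable h volume → (∀ x, ‖h x‖ₑ ≤ A) → A ≠ ⊤ →
      ∫⁻ x, ‖h x‖ₑ ^ θ ≤ A ^ θ * W → lorentzNorm s r h ≤ C * (A * W ^ (1 / s)) := by
  have hs : 0 < s := hθ.trans hθs
  have hd : 0 < 1 - θ / s := by rw [sub_pos, div_lt_one hs]; exact hθs
  set ρ := r.toReal
  set C : ℝ≥0∞ := if r = ⊤ then 1 else ENNReal.ofReal (1 / ((1 - θ / s) * ρ)) ^ (1 / ρ) with hC
  have hρ : r ≠ ⊤ → 0 < ρ := fun hrt => ENNReal.toReal_pos (by positivity) hrt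
  refine ⟨C, ?_, fun h A W hm hA hAt hW => ?_⟩
  · rw [hC]
    split_ifs with hrt
    · simp
    · exact ENNReal.rpow_ne_top_of_nonneg (by have := hρ hrt; positivity) ENNReal.ofReal_ne_top
  obtain ⟨a, ha, rfl⟩ : ∃ a : ℝ, 0 ≤ a ∧ A = ENNReal.ofReal a :=
    ⟨A.toReal, ENNReal.toReal_nonneg, (ENNReal.ofReal_toReal hAt).symm⟩
  have hA' : ∀ x, ‖h x‖ ≤ a := fun x => by
    have := hA x
    rwa [← ofReal_norm, ENNReal.ofReal_le_ofReal_iff ha] at this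
  have key := fun t ht => ofReal_mul_volume_lt_norm_le hm hθ hs ha hA' hW (t := t) ht
  rw [lorentzNorm, hC]
  split_ifs with hrt
  · rw [one_mul]
    refine iSup₂_le fun t ht => (key t ht).trans ?_
    split_ifs with hta
    · refine mul_le_mul_left (ENNReal.ofReal_le_ofReal ?_) _
      have ha0 : 0 < a := ht.trans hta
      calc t ^ (1 - θ / s) * a ^ (θ / s) ≤ a ^ (1 - θ / s) * a ^ (θ / s) := by gcongr
        _ = a := by rw [← Real.rpow_add ha0]; simp
    · exact zero_le
  · have hρ0 := hρ hrt
    have hbound : ∫⁻ t in Ioi (0 : ℝ), (ENNReal.ofReal t * volume {x | t < ‖h x‖} ^ (1 / s)) ^ ρ /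
        ENNReal.ofReal t ≤ ENNReal.ofReal (1 / ((1 - θ / s) * ρ)) *
          (ENNReal.ofReal a * W ^ (1 / s)) ^ ρ := by
      rcases ha.eq_or_lt with ha0 | ha0
      · refine (setLIntegral_mono' (g := fun _ => 0) measurableSet_Ioi fun t ht => ?_).trans ?_
        · have := key t ht
          rw [if_neg (by rw [← ha0]; exact not_lt.2 (le_of_lt ht))] at this
          rw [nonpos_iff_eq_zero.1 this, ENNReal.zero_rpow_of_pos hρ0, ENNReal.zero_div]
        · simp
      have hm' : Measurable fun t : ℝ => ENNReal.ofReal (t ^ ((1 - θ / s) * ρ - 1)) :=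
        (Measurable.pow_const measurable_id _).ennreal_ofReal
      calc _ ≤ ∫⁻ t in Ioi (0 : ℝ), (Ioc 0 a).indicator (fun t =>
            ENNReal.ofReal (t ^ ((1 - θ / s) * ρ - 1)) *
              (ENNReal.ofReal (a ^ (θ / s)) * W ^ (1 / s)) ^ ρ) t := by
            refine setLIntegral_mono' measurableSet_Ioi fun t ht => ?_
            have ht0 : 0 < t := ht
            have hk := key t ht
            split_ifs at hk with hta
            · rw [indicator_of_mem (show t ∈ Ioc 0 a from ⟨ht, hta.le⟩)]
              rw [ENNReal.div_eq_inv_mul, ← ENNReal.ofReal_inv_of_pos ht0]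
              refine (mul_le_mul_right (ENNReal.rpow_le_rpow hk hρ0.le) _).trans_eq ?_
              rw [ENNReal.ofReal_mul (by positivity), mul_assoc,
                ENNReal.mul_rpow_of_nonneg _ _ hρ0.le,
                ENNReal.ofReal_rpow_of_nonneg (by positivity) hρ0.le, ← mul_assoc,
                ← ENNReal.ofReal_mul (by positivity), ← Real.rpow_mul ht0.le,
                Real.rpow_sub_one ht0.ne', div_eq_inv_mul (t ^ ((1 - θ / s) * ρ)) t]
            · rw [nonpos_iff_eq_zero.1 hk, ENNReal.zero_rpow_of_pos hρ0, ENNReal.zero_div]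
              exact zero_le
        _ = ENNReal.ofReal (a ^ ((1 - θ / s) * ρ) / ((1 - θ / s) * ρ)) *
              (ENNReal.ofReal (a ^ (θ / s)) * W ^ (1 / s)) ^ ρ := by
            rw [setLIntegral_indicator measurableSet_Ioc,
              inter_eq_left.2 (show Ioc 0 a ⊆ Ioi (0 : ℝ) from fun t ht => ht.1),
              lintegral_mul_const _ hm',
              lintegral_Ioc_rpow (by linarith [mul_pos hd hρ0]) ha0, sub_add_cancel]
        _ = _ := by
            rw [ENNReal.mul_rpow_of_nonneg _ _ hρ0.le, ENNReal.mul_rpow_of_nonneg _ _ hρ0.le,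
              ENNReal.ofReal_rpow_of_nonneg (by positivity) hρ0.le,
              ENNReal.ofReal_rpow_of_nonneg ha hρ0.le, ← mul_assoc, ← mul_assoc,
              ← ENNReal.ofReal_mul (by positivity), ← ENNReal.ofReal_mul (by positivity)]
            congr 2
            rw [Real.rpow_mul ha, div_mul_eq_mul_div, ← Real.mul_rpow (by positivity) (by positivity),
              ← Real.rpow_add ha0, sub_add_cancel, Real.rpow_one]
            ring
    refine (ENNReal.rpow_le_rpow hbound (by positivity)).trans_eq ?_
    rw [ENNReal.mul_rpow_of_nonneg _ _ (by positivity), ← ENNReal.rpow_mul _ ρ,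
      mul_one_div_cancel hρ0.ne', ENNReal.rpow_one]

end Interpolation

/-! ### Morrey norms -/

section Morrey

variable {n : ℕ} {F : Type*} [NormedAddCommGroup F]

/-- For r < ∞, passing from radius t to τ ∈ (t, 2t] enlarges the ball and shrinks the power factor
by at most 2^c. The local quantity at t is thus controlled by its average over one dyadic interval.
-/
theorem exists_morreyNorm_le {p q : ℝ} (hq : 0 < q) (hqp : q ≤ p) {r : ℝ≥0∞} (hr : 1 ≤ r) :
    ∃ C : ℝ≥0∞, C ≠ ⊤ ∧ ∀ f : Rn n → F, morreyNorm p q f ≤ C * morreyTypeNorm p q r f := by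
  by_cases hrt : r = ⊤
  · exact ⟨1, by simp, fun f => by rw [morreyTypeNorm, if_pos hrt, one_mul, morreyNorm]⟩
  set ρ := r.toReal with hρdef
  have hρ : 0 < ρ := ENNReal.toReal_pos (by positivity) hrt
  set c : ℝ := (n : ℝ) / p - (n : ℝ) / q
  have hc : c ≤ 0 := sub_nonpos.2 (by gcongr)
  have h2c : (0 : ℝ) < 2 ^ c := by positivity
  refine ⟨ENNReal.ofReal ((2 ^ c)⁻¹) * ENNReal.ofReal 2 ^ (1 / ρ), by finiteness, fun f => ?_⟩
  rw [morreyTypeNorm, if_neg hrt, morreyNorm]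
  refine iSup_le fun x => iSup₂_le fun t ht => ?_
  refine le_trans ?_ (mul_le_mul_right (le_iSup (fun x => (∫⁻ t in Ioi (0 : ℝ),
    (morreyLocal p q f x t) ^ ρ / ENNReal.ofReal t) ^ (1 / ρ)) x) _)
  have hlow : ∀ τ ∈ Ioc t (2 * t),
      ENNReal.ofReal (2 ^ c) * morreyLocal p q f x t ≤ morreyLocal p q f x τ := by
    intro τ hτ
    rw [morreyLocal, morreyLocal, ← mul_assoc, ← ENNReal.ofReal_mul h2c.le,
      ← Real.mul_rpow (by norm_num) ht.le]
    refine mul_le_mul' (ENNReal.ofReal_le_ofReal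
      (Real.rpow_le_rpow_of_nonpos (ht.trans hτ.1) hτ.2 hc)) ?_
    exact ENNReal.rpow_le_rpow (lintegral_mono_set (Metric.ball_subset_ball hτ.1.le))
      (by positivity)
  -- The factor 1/2 is the length t of the interval times the lower bound 1/(2t) for 1/τ.
  have hint : ENNReal.ofReal 2⁻¹ * (ENNReal.ofReal (2 ^ c) * morreyLocal p q f x t) ^ ρ ≤
      ∫⁻ t in Ioi (0 : ℝ), (morreyLocal p q f x t) ^ ρ / ENNReal.ofReal t := by
    calc _ = ∫⁻ _ in Ioc t (2 * t), (ENNReal.ofReal (2 ^ c) * morreyLocal p q f x t) ^ ρ *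
          ENNReal.ofReal ((2 * t)⁻¹) := by
          rw [setLIntegral_const, Real.volume_Ioc, mul_assoc, ← ENNReal.ofReal_mul (by positivity),
            mul_comm]
          congr 2
          field_simp
          ring
      _ ≤ ∫⁻ τ in Ioc t (2 * t), (morreyLocal p q f x τ) ^ ρ / ENNReal.ofReal τ := by
          refine setLIntegral_mono' measurableSet_Ioc fun τ hτ => ?_
          have hτ0 : 0 < τ := ht.trans hτ.1
          rw [ENNReal.div_eq_inv_mul, ← ENNReal.ofReal_inv_of_pos hτ0, mul_comm]
          refine mul_le_mul' (ENNReal.ofReal_le_ofReal (inv_anti₀ hτ0 hτ.2))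
            (ENNReal.rpow_le_rpow (hlow τ hτ) hρ.le)
      _ ≤ _ := lintegral_mono_set fun τ hτ => ht.trans hτ.1
  have h3 := ENNReal.rpow_le_rpow hint (z := 1 / ρ) (by positivity)
  rw [ENNReal.mul_rpow_of_nonneg _ _ (by positivity), ← ENNReal.rpow_mul, mul_one_div_cancel hρ.ne',
    ENNReal.rpow_one] at h3
  refine le_trans (le_of_eq ?_) (mul_le_mul_right h3 _)
  calc morreyLocal p q f x t
      = (ENNReal.ofReal ((2 ^ c)⁻¹) * ENNReal.ofReal (2 ^ c)) *
          (ENNReal.ofReal 2 * ENNReal.ofReal 2⁻¹) ^ (1 / ρ) * morreyLocal p q f x t := by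
        rw [← ENNReal.ofReal_mul (by positivity), ← ENNReal.ofReal_mul (by positivity),
          inv_mul_cancel₀ h2c.ne']
        norm_num
    _ = _ := by
        rw [ENNReal.mul_rpow_of_nonneg _ _ (by positivity)]
        ring

/-- Supplies the ball growth, with d = n - θn/p, that the two power-weight lemmas require. Only
balls centred at the singularity of the weight are needed. -/
theorem lintegral_ball_enorm_rpow_le {p q θ : ℝ} (hθ : 0 < θ) (hθq : θ ≤ q) {f : Rn n → F}
    (hf : AEStronglyMeasurable f volume) {ρ : ℝ} (hρ : 0 < ρ) :
    ∫⁻ y in Metric.ball 0 ρ, ‖f y‖ₑ ^ θ ≤ ENNReal.ofReal (ρ ^ ((n : ℝ) - θ * n / p)) *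
      (volume (Metric.ball (0 : Rn n) 1) ^ (1 - θ / q) * morreyNorm p q f ^ θ) := by
  have hq : 0 < q := hθ.trans_le hθq
  have hθ1 : 0 ≤ 1 - θ / q := sub_nonneg.2 ((div_le_one hq).2 hθq)
  have h1 : (∫⁻ y in Metric.ball 0 ρ, ‖f y‖ₑ ^ q) ^ (1 / q) ≤
      ENNReal.ofReal (ρ ^ ((n : ℝ) / q - n / p)) * morreyNorm p q f := by
    have h2 : morreyLocal p q f 0 ρ ≤ morreyNorm p q f :=
      le_iSup_of_le 0 (le_iSup₂_of_le ρ hρ le_rfl)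
    refine le_trans (le_of_eq ?_) (mul_le_mul_right h2 _)
    rw [morreyLocal, ← mul_assoc, ← ENNReal.ofReal_mul (by positivity), ← Real.rpow_add hρ]
    simp
  have h3 := lintegral_rpow_le_rpow_lintegral_rpow
    (hf.enorm.restrict (s := Metric.ball (0 : Rn n) ρ)) hθ hθq
  refine h3.trans ?_
  rw [Measure.restrict_apply_univ, Measure.addHaar_ball_of_pos volume (0 : Rn n) hρ,
    finrank_euclideanSpace_fin, ENNReal.mul_rpow_of_nonneg _ _ hθ1,
    ENNReal.ofReal_rpow_of_nonneg (by positivity) hθ1, ← Real.rpow_natCast, ← Real.rpow_mul hρ.le]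
  have h4 := ENNReal.rpow_le_rpow h1 hθ.le
  rw [← ENNReal.rpow_mul, one_div_mul_eq_div, ENNReal.mul_rpow_of_nonneg _ _ hθ.le,
    ENNReal.ofReal_rpow_of_nonneg (by positivity) hθ.le, ← Real.rpow_mul hρ.le] at h4
  refine (mul_le_mul_left h4 _).trans_eq ?_
  rw [show (n : ℝ) - θ * n / p = ((n : ℝ) / q - n / p) * θ + n * (1 - θ / q) by ring,
    Real.rpow_add hρ, ENNReal.ofReal_mul (by positivity)]
  ring

/-! ### The weighted function and its convolution with the Gaussian majorant. -/

theorem enorm_weighted [NormedSpace ℝ F] (γ : ℝ) (f : Rn n → F) (y : Rn n) :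
    ‖weighted γ f y‖ₑ = ENNReal.ofReal (‖y‖ ^ (-γ)) * ‖f y‖ₑ := by
  rw [weighted, enorm_smul, Real.enorm_of_nonneg (by positivity)]

theorem aestronglyMeasurable_weighted [NormedSpace ℝ F] (γ : ℝ) {f : Rn n → F}
    (hf : AEStronglyMeasurable f volume) : AEStronglyMeasurable (weighted γ f) volume :=
  AEStronglyMeasurable.smul
    (Measurable.pow_const measurable_norm (-γ)).aestronglyMeasurable hf

/-- The Gaussian dominating the derivatives of the heat kernel. -/
noncomputable def gaussianMajorant (n : ℕ) (t : ℝ) (z : Rn n) : ℝ≥0∞ :=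
  ENNReal.ofReal (t ^ (-((n : ℝ) / 2)) * Real.exp (-(1 / 8) * ‖z‖ ^ 2 / t))

theorem measurable_gaussianMajorant (t : ℝ) : Measurable (gaussianMajorant n t) := by
  unfold gaussianMajorant
  fun_prop

theorem gaussianMajorant_le {t : ℝ} (ht : 0 < t) (z : Rn n) :
    gaussianMajorant n t z ≤ ENNReal.ofReal (t ^ (-((n : ℝ) / 2))) := by
  refine ENNReal.ofReal_le_ofReal (mul_le_of_le_one_right (by positivity) (Real.exp_le_one_iff.2 ?_))
  rw [neg_mul, neg_div, neg_nonpos]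
  positivity

theorem lintegral_gaussianMajorant {t : ℝ} (ht : 0 < t) :
    ∫⁻ z, gaussianMajorant n t z = ENNReal.ofReal ((8 * Real.pi) ^ ((n : ℝ) / 2)) := by
  have hb : 0 < 1 / (8 * t) := by positivity
  have h := GaussianFourier.integral_rexp_neg_mul_sq_norm (V := Rn n) hb
  have hi : Integrable fun v : Rn n => Real.exp (-(1 / (8 * t)) * ‖v‖ ^ 2) := by
    -- A non-integrable function has integral 0 by convention, whereas the Gaussian formula gives a
    -- positive value.
    by_contra hcon
    rw [integral_undef hcon] at h
    have : 0 < (Real.pi / (1 / (8 * t))) ^ ((Module.finrank ℝ (Rn n) : ℝ) / 2) := by positivity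
    linarith
  have e : ∀ z : Rn n, gaussianMajorant n t z = ENNReal.ofReal (t ^ (-((n : ℝ) / 2))) *
      ENNReal.ofReal (Real.exp (-(1 / (8 * t)) * ‖z‖ ^ 2)) := fun z => by
    rw [gaussianMajorant, ENNReal.ofReal_mul (by positivity)]
    congr 3
    field_simp
  simp only [e]
  rw [lintegral_const_mul' _ _ ENNReal.ofReal_ne_top, ← ofReal_integral_eq_lintegral_ofReal hi
    (Filter.Eventually.of_forall fun _ => (Real.exp_pos _).le), h,
    ← ENNReal.ofReal_mul (by positivity), finrank_euclideanSpace_fin]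
  congr 1
  rw [show Real.pi / (1 / (8 * t)) = 8 * Real.pi * t by field_simp,
    Real.mul_rpow (by positivity) ht.le, mul_left_comm, ← Real.rpow_add ht]
  simp

/-- The central estimate. The upper bound on γ gives integrability inside B(0, √t), the lower bound
gives L^θ outside, and the radius √t makes both contributions scale identically in t. -/
theorem exists_gaussianMajorant_conv_bound [NormedSpace ℝ F] {p q θ γ : ℝ} (hθ : 1 ≤ θ)
    (hθq : θ ≤ q) (hγ : 0 < γ) (hγ₁ : (n : ℝ) / θ - n / p < γ) (hγ₂ : γ < (n : ℝ) - n / p) :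
    ∃ D : ℝ≥0∞, D ≠ ⊤ ∧ 1 ≤ D ∧ ∀ f : Rn n → F, AEStronglyMeasurable f volume →
      ∀ t : ℝ, 0 < t →
      (∀ x, ∫⁻ y, gaussianMajorant n t (x - y) * ‖weighted γ f y‖ₑ ≤
        D * (ENNReal.ofReal (t ^ (-(γ + n / p) / 2)) * morreyNorm p q f)) ∧
      ∫⁻ x, (∫⁻ y, gaussianMajorant n t (x - y) * ‖weighted γ f y‖ₑ) ^ θ ≤
        D * (ENNReal.ofReal (t ^ ((n : ℝ) / 2)) *
          (ENNReal.ofReal (t ^ (-(γ + n / p) / 2)) * morreyNorm p q f) ^ θ) := by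
  have hθ0 : 0 < θ := by linarith
  have hq : 0 < q := by linarith
  set v : ℝ≥0∞ := volume (Metric.ball (0 : Rn n) 1)
  have hv : v ≠ ⊤ := measure_ball_lt_top.ne
  have hv1 : v ^ (1 - 1 / q) ≠ ⊤ := ENNReal.rpow_ne_top_of_nonneg
    (sub_nonneg.2 ((div_le_one hq).2 (by linarith))) hv
  have hv2 : v ^ (1 - θ / q) ≠ ⊤ := ENNReal.rpow_ne_top_of_nonneg
    (sub_nonneg.2 ((div_le_one hq).2 hθq)) hv
  have hθγ : (n : ℝ) - θ * n / p < γ * θ := by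
    have := mul_lt_mul_of_pos_right hγ₁ hθ0
    rw [sub_mul, div_mul_cancel₀ _ hθ0.ne'] at this
    linarith [show θ * n / p = n / p * θ by ring]
  obtain ⟨D, hD, hD1, hDb⟩ := exists_conv_bound (n := n) hθ
    (Q := ENNReal.ofReal ((8 * Real.pi) ^ ((n : ℝ) / 2)))
    (C₁ := ENNReal.ofReal (((n : ℝ) - n / p) / ((n : ℝ) - n / p - γ)) * v ^ (1 - 1 / q))
    (C₂ := ENNReal.ofReal (γ * θ / (γ * θ - ((n : ℝ) - θ * n / p))) * v ^ (1 - θ / q))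
    ENNReal.ofReal_ne_top (ENNReal.mul_ne_top ENNReal.ofReal_ne_top hv1)
    (ENNReal.mul_ne_top ENNReal.ofReal_ne_top hv2)
  refine ⟨D, hD, hD1, fun f hf t ht => ?_⟩
  have hR : 0 < √t := Real.sqrt_pos.2 ht
  have hw := aestronglyMeasurable_weighted γ hf
  refine hDb (ENNReal.ofReal (t ^ (-((n : ℝ) / 2)))) (ENNReal.ofReal (t ^ ((n : ℝ) / 2))) _
    (gaussianMajorant n t) _ (Metric.ball 0 (√t)) (measurable_gaussianMajorant t) hw.enorm
    Metric.isOpen_ball.measurableSet ?_ (gaussianMajorant_le ht) (lintegral_gaussianMajorant ht)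
    ?_ ?_
  · rw [← ENNReal.ofReal_mul (by positivity), ← Real.rpow_add ht]
    simp
  · simp only [enorm_weighted]
    refine (setLIntegral_ball_norm_rpow_neg_mul_le hf.enorm hγ hγ₂
      (N := v ^ (1 - 1 / q) * morreyNorm p q f) hR fun ρ hρ => ?_).trans_eq ?_
    · simpa using lintegral_ball_enorm_rpow_le (p := p) one_pos (hθ.trans hθq) hf hρ
    · have e : √t ^ ((n : ℝ) - n / p - γ) =
          t ^ ((n : ℝ) / 2) * t ^ (-(γ + n / p) / 2) := by
        rw [← Real.rpow_add ht, Real.sqrt_eq_rpow, ← Real.rpow_mul ht.le]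
        congr 1
        ring
      rw [e, ENNReal.ofReal_mul (by positivity)]
      ring
  · have e0 : ∀ y, ‖weighted γ f y‖ₑ ^ θ =
        ENNReal.ofReal (‖y‖ ^ (-(γ * θ))) * ‖f y‖ₑ ^ θ := fun y => by
      rw [enorm_weighted, ENNReal.mul_rpow_of_nonneg _ _ hθ0.le,
        ENNReal.ofReal_rpow_of_nonneg (by positivity) hθ0.le, ← Real.rpow_mul (norm_nonneg _),
        neg_mul]
    simp only [e0]
    refine (setLIntegral_compl_ball_norm_rpow_neg_mul_le (hf.enorm.pow_const θ)
      (mul_pos hγ hθ0) hθγ (N := v ^ (1 - θ / q) * morreyNorm p q f ^ θ) hR fun ρ hρ =>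
        lintegral_ball_enorm_rpow_le hθ0 hθq hf hρ).trans_eq ?_
    have e : √t ^ ((n : ℝ) - θ * n / p - γ * θ) =
        t ^ ((n : ℝ) / 2) * (t ^ (-(γ + n / p) / 2)) ^ θ := by
      rw [← Real.rpow_mul ht.le, ← Real.rpow_add ht, Real.sqrt_eq_rpow, ← Real.rpow_mul ht.le]
      congr 1
      ring
    rw [e, ENNReal.ofReal_mul (by positivity), ENNReal.mul_rpow_of_nonneg _ _ hθ0.le,
      ENNReal.ofReal_rpow_of_nonneg (by positivity) hθ0.le]
    ring

end Morrey

/-! ### Bounds for the heat semigroup -/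

section Heat

variable {n : ℕ} {F : Type*} [NormedAddCommGroup F] [NormedSpace ℝ F]

theorem gaussIntegrable_of_lintegral_lt_top {g : Rn n → F} (hg : AEStronglyMeasurable g volume)
    (h : ∀ t : ℝ, 0 < t → ∀ x, ∫⁻ y, gaussianMajorant n t (x - y) * ‖g y‖ₑ < ⊤) :
    GaussIntegrable g := by
  intro c hc x
  have hcont : Continuous fun y : Rn n => Real.exp (-c * ‖x - y‖ ^ 2) := by fun_prop
  refine ⟨hcont.aestronglyMeasurable.smul hg, ?_⟩
  -- The time at which the majorant has exactly the rate c.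
  have ht : 0 < 1 / (8 * c) := by positivity
  set t := 1 / (8 * c) with htc
  have e : ∀ y, ‖Real.exp (-c * ‖x - y‖ ^ 2) • g y‖ₑ =
      ENNReal.ofReal (t ^ ((n : ℝ) / 2)) * (gaussianMajorant n t (x - y) * ‖g y‖ₑ) := fun y => by
    rw [enorm_smul, Real.enorm_of_nonneg (Real.exp_pos _).le, gaussianMajorant, ← mul_assoc,
      ← ENNReal.ofReal_mul (by positivity), ← mul_assoc, ← Real.rpow_add ht]
    congr 2
    rw [show -(1 / 8) * ‖x - y‖ ^ 2 / t = -c * ‖x - y‖ ^ 2 by rw [htc]; field_simp]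
    simp
  rw [HasFiniteIntegral]
  simp only [e]
  rw [lintegral_const_mul' _ _ ENNReal.ofReal_ne_top]
  exact ENNReal.mul_lt_top ENNReal.ofReal_lt_top (h t ht x)

theorem IsHeatKernel.exists_enorm_kernelConv_le {m : ℕ} {K : ℝ × Rn n → ℝ}
    (h : IsHeatKernel n m K) : ∃ C : ℝ≥0∞, C ≠ ⊤ ∧ ∀ (g : Rn n → F) (t : ℝ), 0 < t → ∀ x,
      ‖kernelConv K g (t, x)‖ₑ ≤ C * ENNReal.ofReal (t ^ (-((m : ℝ) / 2))) *
        ∫⁻ y, gaussianMajorant n t (x - y) * ‖g y‖ₑ := by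
  obtain ⟨C, hC, hb⟩ := h.exists_bound (c := 1 / 8) (by norm_num)
  refine ⟨ENNReal.ofReal C, ENNReal.ofReal_ne_top, fun g t ht x => ?_⟩
  refine (enorm_integral_le_lintegral_enorm _).trans ?_
  rw [← lintegral_const_mul' _ _ (by finiteness)]
  refine lintegral_mono fun y => ?_
  rw [enorm_smul, ← mul_assoc]
  refine mul_le_mul_left ?_ _
  rw [Real.enorm_eq_ofReal_abs, gaussianMajorant, ← ENNReal.ofReal_mul hC,
    ← ENNReal.ofReal_mul (by positivity)]
  refine ENNReal.ofReal_le_ofReal ((hb t ht (x - y)).trans_eq ?_)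
  rw [sub_eq_add_neg, Real.rpow_add ht]
  ring

theorem exists_heatDeriv_bound [CompleteSpace F] (k : ℕ) (α : Fin n → ℕ) {p q θ γ : ℝ}
    (hθ : 1 ≤ θ) (hθq : θ ≤ q) (hγ : 0 < γ) (hγ₁ : (n : ℝ) / θ - n / p < γ)
    (hγ₂ : γ < (n : ℝ) - n / p) :
    ∃ D : ℝ≥0∞, D ≠ ⊤ ∧ ∀ f : Rn n → F, MemMorrey p q f → HeatSmooth (weighted γ f) ∧
      ∀ t : ℝ, 0 < t → AEStronglyMeasurable (heatDeriv k α t (weighted γ f)) volume ∧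
      ∃ A : ℝ≥0∞, A = D * (ENNReal.ofReal (t ^ (-((2 * k + ∑ i, α i : ℕ) : ℝ) / 2 -
          (γ + n / p) / 2)) * morreyNorm p q f) ∧
        (∀ x, ‖heatDeriv k α t (weighted γ f) x‖ₑ ≤ A) ∧
        ∫⁻ x, ‖heatDeriv k α t (weighted γ f) x‖ₑ ^ θ ≤
          A ^ θ * (D * ENNReal.ofReal (t ^ ((n : ℝ) / 2))) := by
  have hθ0 : 0 < θ := by linarith
  obtain ⟨B, hB, hB1, hBb⟩ := exists_gaussianMajorant_conv_bound (F := F) hθ hθq hγ hγ₁ hγ₂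
  obtain ⟨L, hL, hLe⟩ := exists_heatDeriv_eq (F := F) k α
  obtain ⟨C, hC, hCb⟩ := hL.exists_enorm_kernelConv_le (F := F)
  -- With C + 1 ≥ 1 and B ≥ 1 this product dominates both B and C, so a single constant serves in
  -- the sup bound and in the L^θ bound.
  refine ⟨(C + 1) * B, by finiteness, fun f hf => ?_⟩
  have hg : GaussIntegrable (weighted γ f) :=
    gaussIntegrable_of_lintegral_lt_top (aestronglyMeasurable_weighted γ hf.1) fun t ht x =>
      ((hBb f hf.1 t ht).1 x).trans_lt (ENNReal.mul_lt_top hB.lt_top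
        (ENNReal.mul_lt_top ENNReal.ofReal_lt_top hf.2))
  refine ⟨hg.heatSmooth, fun t ht => ?_⟩
  obtain ⟨hb1, hb2⟩ := hBb f hf.1 t ht
  have hfun : heatDeriv k α t (weighted γ f) = fun x => kernelConv L (weighted γ f) (t, x) :=
    funext (hLe _ hg t ht)
  have hpt : ∀ x, ‖heatDeriv k α t (weighted γ f) x‖ₑ ≤
      C * ENNReal.ofReal (t ^ (-((2 * k + ∑ i, α i : ℕ) : ℝ) / 2)) *
        ∫⁻ y, gaussianMajorant n t (x - y) * ‖weighted γ f y‖ₑ := fun x => by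
    rw [hLe _ hg t ht, neg_div]
    exact hCb _ t ht x
  set m : ℝ := ((2 * k + ∑ i, α i : ℕ) : ℝ)
  set M := morreyNorm p q f
  refine ⟨?_, _, rfl, fun x => (hpt x).trans ?_, ?_⟩
  · rw [hfun]
    have h1 := (hL.contDiffOn 0 hg).continuousOn.comp_continuous
      (f := fun x : Rn n => (t, x)) (by fun_prop) fun x => ⟨ht, mem_univ _⟩
    exact h1.aestronglyMeasurable
  · refine (mul_le_mul_right (hb1 x) _).trans ?_
    rw [sub_eq_add_neg, Real.rpow_add ht, ENNReal.ofReal_mul (by positivity), neg_div]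
    calc C * ENNReal.ofReal (t ^ (-(m / 2))) * (B * (ENNReal.ofReal (t ^ (-(γ + n / p) / 2)) * M))
        = C * (B * (ENNReal.ofReal (t ^ (-(m / 2))) *
            ENNReal.ofReal (t ^ (-(γ + n / p) / 2)) * M)) := by ring
      _ ≤ (C + 1) * (B * (ENNReal.ofReal (t ^ (-(m / 2))) *
            ENNReal.ofReal (t ^ (-(γ + n / p) / 2)) * M)) := mul_le_mul_left le_self_add _
      _ = _ := by rw [neg_div]; ring
  · set T := ENNReal.ofReal (t ^ (-m / 2))
    set X := ENNReal.ofReal (t ^ (-(γ + n / p) / 2)) * M with hX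
    have hT : T ≠ ⊤ := ENNReal.ofReal_ne_top
    calc ∫⁻ x, ‖heatDeriv k α t (weighted γ f) x‖ₑ ^ θ
        ≤ ∫⁻ x, (C * T) ^ θ *
            (∫⁻ y, gaussianMajorant n t (x - y) * ‖weighted γ f y‖ₑ) ^ θ := by
          refine lintegral_mono fun x => ?_
          rw [← ENNReal.mul_rpow_of_nonneg _ _ hθ0.le]
          exact ENNReal.rpow_le_rpow (hpt x) hθ0.le
      _ = (C * T) ^ θ * ∫⁻ x,
            (∫⁻ y, gaussianMajorant n t (x - y) * ‖weighted γ f y‖ₑ) ^ θ :=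
          lintegral_const_mul' _ _ (ENNReal.rpow_ne_top_of_nonneg hθ0.le (by finiteness))
      _ ≤ (C * T) ^ θ * (B * (ENNReal.ofReal (t ^ ((n : ℝ) / 2)) * X ^ θ)) := by gcongr
      _ = (C * T * X) ^ θ * (B * ENNReal.ofReal (t ^ ((n : ℝ) / 2))) := by
          rw [ENNReal.mul_rpow_of_nonneg _ X hθ0.le]
          ring
      _ ≤ _ := by
          have hC1 : 1 ≤ C + 1 := le_add_self
          refine mul_le_mul' (ENNReal.rpow_le_rpow ?_ hθ0.le)
            (mul_le_mul_left (le_mul_of_one_le_left' hC1) _)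
          rw [sub_eq_add_neg, Real.rpow_add ht, ENNReal.ofReal_mul (by positivity), ← neg_div,
            mul_assoc (ENNReal.ofReal _), ← hX, mul_assoc]
          refine mul_le_mul_left ?_ _
          calc C ≤ C + 1 := le_self_add
            _ ≤ _ := le_mul_of_one_le_right' hB1

/-- The strict lower bound on γ survives lowering q slightly, and q > 1 leaves room for θ ≥ 1.
Taking θ < q secures θ < s even when q = s. The critical exponent is n/(γ + n/p). -/
theorem exists_exponent {n p q s γ : ℝ} (hn : 0 < n) (hq : 1 < q) (hp : 0 < p) (hqs : q ≤ s)
    (hγ : 0 < γ) (hγ₁ : n / q - n / p < γ) :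
    ∃ θ : ℝ, 1 ≤ θ ∧ θ ≤ q ∧ θ < s ∧ n / θ - n / p < γ := by
  have hg : 0 < γ + n / p := by positivity
  have hu : n / (γ + n / p) < q := by
    rw [div_lt_iff₀ hg]
    rw [sub_lt_iff_lt_add, div_lt_iff₀ (by linarith)] at hγ₁
    linarith
  have hmax : max 1 (n / (γ + n / p)) < q := max_lt hq hu
  obtain ⟨θ, h1, h2⟩ := exists_between hmax
  obtain ⟨h3, h4⟩ := max_lt_iff.1 h1
  refine ⟨θ, h3.le, h2.le, h2.trans_le hqs, ?_⟩
  rw [div_lt_iff₀ hg] at h4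
  rw [sub_lt_iff_lt_add, div_lt_iff₀ (by linarith)]
  linarith

/-- Bookkeeping of exponents: the effective volume t^{n/2}, raised to 1/s, contributes the n/(2s).
The added 1 keeps the real constant positive. -/
theorem const_mul_rpow_bound {n p s γ t m : ℝ} {a : ℕ} {k : ℕ} (hs : 0 < s) (ht : 0 < t)
    (hm : m = ((2 * k + a : ℕ) : ℝ)) {C D M : ℝ≥0∞} (hC : C ≠ ⊤) (hD : D ≠ ⊤) :
    C * (D * (ENNReal.ofReal (t ^ (-m / 2 - (γ + n / p) / 2)) * M) *
        (D * ENNReal.ofReal (t ^ (n / 2))) ^ (1 / s)) ≤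
      ENNReal.ofReal (((C * (D * D ^ (1 / s))).toReal + 1) *
        t ^ (-(n / 2) * (1 / p - 1 / s) - (k : ℝ) - (a : ℝ) / 2 - γ / 2)) * M := by
  have hfin : C * (D * D ^ (1 / s)) ≠ ⊤ :=
    ENNReal.mul_ne_top hC (ENNReal.mul_ne_top hD (ENNReal.rpow_ne_top_of_nonneg (by positivity) hD))
  have e : t ^ (-(n / 2) * (1 / p - 1 / s) - (k : ℝ) - (a : ℝ) / 2 - γ / 2) =
      t ^ (-m / 2 - (γ + n / p) / 2) * (t ^ (n / 2)) ^ (1 / s) := by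
    rw [← Real.rpow_mul ht.le, ← Real.rpow_add ht, hm]
    congr 1
    push_cast
    ring
  rw [e, ENNReal.ofReal_mul (by positivity), ENNReal.ofReal_mul (by positivity),
    ENNReal.mul_rpow_of_nonneg _ _ (by positivity),
    ENNReal.ofReal_rpow_of_nonneg (by positivity) (by positivity)]
  have h1 : C * (D * D ^ (1 / s)) ≤ ENNReal.ofReal ((C * (D * D ^ (1 / s))).toReal + 1) := by
    conv_lhs => rw [← ENNReal.ofReal_toReal hfin]
    exact ENNReal.ofReal_le_ofReal (by linarith)
  refine le_trans (le_of_eq ?_) (mul_le_mul_left (mul_le_mul_left h1 _) _)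
  ring

end Heat

end HeatMorrey

/-! ### Main theorem: assembly of the estimates. -/

theorem mainTheorem2 {𝕜 : Type*} [RCLike 𝕜] (n k : ℕ) (α : Fin n → ℕ) (p q s γ : ℝ) (r : ℝ≥0∞)
    (hq : 1 < q) (hqp : q ≤ p) (hr : 1 ≤ r) (hs : 1 < s) (hγ : 0 < γ)
    (hγ₁ : (n : ℝ) / q - (n : ℝ) / p < γ) (hγ₂ : γ < (n : ℝ) - (n : ℝ) / p) :
    (q ≤ s → ∃ C : ℝ, 0 < C ∧ ∀ f : HeatMorrey.Rn n → 𝕜, HeatMorrey.MemMorreyType p q r f →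
      HeatMorrey.HeatSmooth (HeatMorrey.weighted γ f) ∧
      ∀ t : ℝ, 0 < t →
        HeatMorrey.lorentzNorm s r (HeatMorrey.heatDeriv k α t (HeatMorrey.weighted γ f)) ≤
          ENNReal.ofReal (C * t ^ (-((n : ℝ) / 2) * (1 / p - 1 / s) - (k : ℝ)
            - ((∑ i, α i : ℕ) : ℝ) / 2 - γ / 2)) * HeatMorrey.morreyTypeNorm p q r f) ∧
    (q < s → ∃ C : ℝ, 0 < C ∧ ∀ f : HeatMorrey.Rn n → 𝕜, HeatMorrey.MemMorrey p q f →
      HeatMorrey.HeatSmooth (HeatMorrey.weighted γ f) ∧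
      ∀ t : ℝ, 0 < t →
        eLpNorm (HeatMorrey.heatDeriv k α t (HeatMorrey.weighted γ f)) (ENNReal.ofReal s) volume ≤
          ENNReal.ofReal (C * t ^ (-((n : ℝ) / 2) * (1 / p - 1 / s) - (k : ℝ)
            - ((∑ i, α i : ℕ) : ℝ) / 2 - γ / 2)) * HeatMorrey.morreyNorm p q f) := by
  have hs0 : 0 < s := by linarith
  have hp : 0 < p := by linarith
  -- For n = 0 the upper bound would force γ < 0.
  have hn : (0 : ℝ) < n := by
    rcases (Nat.cast_nonneg n : (0 : ℝ) ≤ n).eq_or_lt with h | h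
    · rw [← h] at hγ₂
      simp only [zero_div, sub_zero] at hγ₂
      linarith
    · exact h
  constructor
  · intro hqs
    obtain ⟨θ, h1, h2, h3, h4⟩ := HeatMorrey.exists_exponent hn hq hp hqs hγ hγ₁
    obtain ⟨D, hD, hDb⟩ := HeatMorrey.exists_heatDeriv_bound (F := 𝕜) k α h1 h2 hγ h4 hγ₂
    obtain ⟨C, hC, hCb⟩ := HeatMorrey.exists_lorentzNorm_le_of_bounded (n := n) (F := 𝕜)
      (by linarith) h3 hr
    obtain ⟨B, hB, hBb⟩ := HeatMorrey.exists_morreyNorm_le (n := n) (F := 𝕜)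
      (by linarith) hqp hr
    refine ⟨(C * B * (D * D ^ (1 / s))).toReal + 1, by positivity, fun f hf => ?_⟩
    have hf' : HeatMorrey.MemMorrey p q f :=
      ⟨hf.1, (hBb f).trans_lt (ENNReal.mul_lt_top hB.lt_top hf.2)⟩
    refine ⟨(hDb f hf').1, fun t ht => ?_⟩
    obtain ⟨hm, A, hA, hb, hi⟩ := (hDb f hf').2 t ht
    have hAt : A ≠ ⊤ := by
      rw [hA]
      exact ENNReal.mul_ne_top hD (ENNReal.mul_ne_top ENNReal.ofReal_ne_top hf'.2.ne)
    refine (hCb _ A _ hm hb hAt hi).trans ?_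
    refine le_trans ?_ (HeatMorrey.const_mul_rpow_bound hs0 ht rfl (ENNReal.mul_ne_top hC hB) hD)
    rw [hA, mul_assoc C B]
    refine mul_le_mul_right ?_ _
    calc _ ≤ D * (ENNReal.ofReal (t ^ (-((2 * k + ∑ i, α i : ℕ) : ℝ) / 2 - (γ + n / p) / 2)) *
          (B * HeatMorrey.morreyTypeNorm p q r f)) *
          (D * ENNReal.ofReal (t ^ ((n : ℝ) / 2))) ^ (1 / s) := by
          gcongr
          exact hBb f
      _ = _ := by ring
  · intro hqs
    obtain ⟨θ, h1, h2, h3, h4⟩ := HeatMorrey.exists_exponent hn hq hp hqs.le hγ hγ₁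
    obtain ⟨D, hD, hDb⟩ := HeatMorrey.exists_heatDeriv_bound (F := 𝕜) k α h1 h2 hγ h4 hγ₂
    refine ⟨(1 * (D * D ^ (1 / s))).toReal + 1, by positivity, fun f hf => ?_⟩
    refine ⟨(hDb f hf).1, fun t ht => ?_⟩
    obtain ⟨-, A, hA, hb, hi⟩ := (hDb f hf).2 t ht
    have hAt : A ≠ ⊤ := by
      rw [hA]
      exact ENNReal.mul_ne_top hD (ENNReal.mul_ne_top ENNReal.ofReal_ne_top hf.2.ne)
    refine (HeatMorrey.eLpNorm_le_of_bounded (by linarith) h3 hb hAt hi).trans ?_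
    refine le_trans ?_ (HeatMorrey.const_mul_rpow_bound hs0 ht rfl ENNReal.one_ne_top hD)
    rw [hA, one_mul]
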